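/- For a function $f:[0,1]\to(0,1)$, the generalized reinforced random walk $(X_n)_{n\ge 0}$ on $\mathbb{Z}$ associated to $f$, started at $0$ with all initial urns equal to $(\alpha_0,l_0)\in[0,1]\times(0,\infty)$, is defined as follows. $X_0=0$. Given $X_0,\dots,X_n$ with $X_n=x$, put $$\tilde\alpha_n^x=\frac{\alpha_0l_0+\#\{k<n: X_k=x,\ X_{k+1}=x+1\}}{l_0+\#\{k<n: X_k=x\}};$$ then $X_{n+1}=x+1$ with probability $f(\tilde\alpha_n^x)$ and $X_{n+1}=x-1$ with probability $1-f(\tilde\alpha_n^x)$. A path is recurrent if it visits every site of $\mathbb{Z}$ infinitely often, and transient if it converges to $+\infty$ or to $-\infty$. A point $p\in[0,1]$ is a stable fixed point of $f$ if $f(p)=p$ and $f'(p)\le 1$. **Theorem.** There exist a function $f:[0,1]\to(0,1)$ of class $C^3$, all of whose fixed points are isolated, with $f\ge 1/2$ on $[0,1]$ and with $1/2$ as its unique stable fixed point, and a real number $l_1>0$, such that for every real $l>0$ the walk associated to $f$, started at $0$ with all initial urns equal to $(1/2,l)$, is almost surely recurrent if $l\ge l_1$, and almost surely transient if $l<l_1$.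 -/

import Mathlib

open Set Filter Topology MeasureTheory ProbabilityTheory

/-- The standing assumptions on the urn function: `f : [0,1] → (0,1)` is of class `C³` and all
its fixed points are isolated. Only the values of `f` on `[0,1]` matter. -/
structure IsUrnFunction (f : ℝ → ℝ) : Prop where
  contDiffOn : ContDiffOn ℝ 3 f (Icc 0 1)
  mapsTo : MapsTo f (Icc 0 1) (Ioo 0 1)
  isolated : ∀ p ∈ Icc (0 : ℝ) 1, f p = p → ∀ᶠ x in 𝓝[≠] p, x ∈ Icc (0 : ℝ) 1 → f x ≠ x

/-- A fixed point `p ∈ [0,1]` of `f` is stable if `f' p ≤ 1` (the derivative is the one of `f` as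
a function on `[0,1]`). -/
def IsStableFixedPoint (f : ℝ → ℝ) (p : ℝ) : Prop :=
  p ∈ Icc (0 : ℝ) 1 ∧ f p = p ∧ derivWithin f (Icc 0 1) p ≤ 1

/-- An environment: the urn at the site `x` is `w x = (proportion of red balls, number of balls)`;
both are real. -/
abbrev UrnEnvironment : Type := ℤ → ℝ × ℝ

/-- The number of visits of the path `X` to the site `x` strictly before time `n`. -/
def visits (X : ℕ → ℤ) (n : ℕ) (x : ℤ) : ℕ :=
  ((Finset.range n).filter fun k => X k = x).card

/-- The number of jumps of the path `X` from `x` to `x + 1` up to time `n`. -/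
def rightJumps (X : ℕ → ℤ) (n : ℕ) (x : ℤ) : ℕ :=
  ((Finset.range n).filter fun k => X k = x ∧ X (k + 1) = x + 1).card

/-- The proportion of red balls at time `n` in the urn at `x`, when the initial environment is `w`,
and the walk has followed the path `X` up to time `n`. -/
noncomputable def redProportion (w : UrnEnvironment) (X : ℕ → ℤ) (n : ℕ) (x : ℤ) : ℝ :=
  ((w x).1 * (w x).2 + rightJumps X n x) / ((w x).2 + visits X n x)

/-- A finite path `X 0, …, X n`, extended by `0` to all times. -/
def extendPath {n : ℕ} (h : Finset.Iic n → ℤ) (k : ℕ) : ℤ :=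
  if hk : k ≤ n then h ⟨k, Finset.mem_Iic.2 hk⟩ else 0

/-- The law of the next position given the path `h` up to time `n`: from the current position `x`
the walk jumps to `x + 1` with probability `f a` and to `x - 1` with probability `1 - f a`, where
`a` is the current proportion of red balls in the urn at `x`. The projection `Set.projIcc` only
records that `f a` is a probability; it is the identity when `f` maps `[0,1]` to itself. -/
noncomputable def stepKernel (f : ℝ → ℝ) (w : UrnEnvironment) (n : ℕ) :
    Kernel (Finset.Iic n → ℤ) ℤ :=
  Kernel.ofFunOfCountable fun h =>
    bernoulliMeasure (extendPath h n + 1) (extendPath h n - 1)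
      (projIcc (0 : ℝ) 1 zero_le_one (f (redProportion w (extendPath h) n (extendPath h n))))

instance (f : ℝ → ℝ) (w : UrnEnvironment) (n : ℕ) : IsMarkovKernel (stepKernel f w n) :=
  ⟨fun _ => by unfold stepKernel Kernel.ofFunOfCountable; dsimp; infer_instance⟩

/-- The law, on the space of paths `ℕ → ℤ`, of the generalized reinforced random walk associated
to `f`, started at `x₀` with initial environment `w`. -/
noncomputable def reinforcedWalkLaw (f : ℝ → ℝ) (x₀ : ℤ) (w : UrnEnvironment) :
    Measure (ℕ → ℤ) :=
  Kernel.trajMeasure (X := fun _ => ℤ) (Measure.dirac x₀) (stepKernel f w)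

instance (f : ℝ → ℝ) (x₀ : ℤ) (w : UrnEnvironment) :
    IsProbabilityMeasure (reinforcedWalkLaw f x₀ w) := by
  unfold reinforcedWalkLaw; infer_instance

/-- The path visits every site infinitely often. -/
def IsRecurrentPath (X : ℕ → ℤ) : Prop :=
  ∀ x : ℤ, ∃ᶠ n in atTop, X n = x

/-- The path converges to `+∞` or to `-∞`. -/
def IsTransientPath (X : ℕ → ℤ) : Prop :=
  Tendsto X atTop atTop ∨ Tendsto X atTop atBot

/-! Give each site a stack of draws from its own urn, `true` meaning a jump to the right. An urn
only records jumps from its site, so the stacks are independent with a common law, and the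
reinforced walk is the deterministic walk that reads them (`map_walk_eq_reinforcedWalkLaw`).

Up to the first hit of `K`, the left jumps from `K - 1, …, 0` form a branching process with one
immigrant: if `x + 1` was left `v` times to the left, then `x` was left `v + 1` times to the right,
and the left jumps from `x` are the `false`s before the `(v + 1)`-th `true`. Its value at `0` is
`chain ω K`. Almost every stack contains both values infinitely often, so the walk is recurrent or
diverges. If `chain` is bounded in `K`, recurrence fails; if it is unbounded, divergence to `+∞`
fails, and the mirrored process handles `-∞`.

By Wald's identity the mean offspring of `v` is `v + 1 - δ(v)`, where `δ(v)` is the expected sum of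
`2p - 1` over the draws up to the `(v + 1)`-th `true` (`siteDrift`), which increases to the total
drift `D`. If `D > 1`, large values decrease in mean by a fixed amount, so the process cannot escape
(`ae_mem_boundedStacks`). If every `δ(v) < 1`, the mean strictly increases from every value, which
no stationary limit allows (`ae_notMem_boundedStacks`). Since `f ≥ 1/2`, mirrored urns have no
positive drift, and the same criterion excludes `-∞`.

It remains to study `D` as a function of `l` for `f = plateau`. A larger initial urn keeps the
proportion closer to `1/2`, so `D` is antitone; it is at most one for some `l`, exceeds one for
small `l`, and `{D > 1}` is open. Hence `{D ≤ 1}` is a closed half-line. At `D = 1` each `δ(v)` is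
still below one, because some drift always remains to be used (`siteDrift_lt_one`); the critical
value is therefore recurrent. -/

/-! ### Stacks of arrows and the branching process of left jumps. -/

/-- The number of `true`s among the first `n` entries of a sequence. -/
def heads (a : ℕ → Bool) (n : ℕ) : ℕ := Nat.count (fun i => a i = true) n

/-- The number of `false`s strictly before the `(v + 1)`-th `true` of the sequence. -/
noncomputable def backJumps (a : ℕ → Bool) (v : ℕ) : ℕ := Nat.nth (fun i => a i = true) v - v

/-- The branching process of backward jumps: `chain ω n` is
`backJumps (ω 0) (backJumps (ω 1) (⋯ (backJumps (ω (n - 1)) 0)))`. -/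
noncomputable def chain : (ℕ → ℕ → Bool) → ℕ → ℕ
  | _, 0 => 0
  | ω, n + 1 => backJumps (ω 0) (chain (fun x => ω (x + 1)) n)

/-- Both values occur infinitely often in the sequence. -/
def IsMixed (a : ℕ → Bool) : Prop :=
  {i | a i = true}.Infinite ∧ {i | a i = false}.Infinite

/-- The path starts at `0` and at its `i`-th visit to `x` it goes right if and only if
`ω x i` is `true`. -/
def Follows (ω : ℤ → ℕ → Bool) (X : ℕ → ℤ) : Prop :=
  X 0 = 0 ∧ ∀ n, X (n + 1) = if ω (X n) (visits X n (X n)) then X n + 1 else X n - 1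

/-- The number of jumps of the path `X` from `x` to `x - 1` up to time `n`. -/
def leftJumps (X : ℕ → ℤ) (n : ℕ) (x : ℤ) : ℕ :=
  ((Finset.range n).filter fun k => X k = x ∧ X (k + 1) = x - 1).card

theorem heads_zero (a : ℕ → Bool) : heads a 0 = 0 := by simp [heads]

theorem heads_succ (a : ℕ → Bool) (n : ℕ) :
    heads a (n + 1) = heads a n + if a n then 1 else 0 := by
  simp [heads, Nat.count_succ]

theorem heads_le (a : ℕ → Bool) (n : ℕ) : heads a n ≤ n := Nat.count_le _

theorem heads_congr {a b : ℕ → Bool} {n : ℕ} (h : ∀ i < n, a i = b i) : heads a n = heads b n := by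
  induction n with
  | zero => simp [heads_zero]
  | succ n ih =>
    rw [heads_succ, heads_succ, ih fun i hi => h i (by omega), h n (by omega)]

theorem heads_not (a : ℕ → Bool) (n : ℕ) : heads (fun i => !a i) n = n - heads a n := by
  induction n with
  | zero => simp [heads_zero]
  | succ n ih =>
    have := heads_le a n
    rw [heads_succ, heads_succ, ih]
    cases a n
    · simp
      omega
    · simp

theorem IsMixed.not {a : ℕ → Bool} (h : IsMixed a) : IsMixed fun i => !a i := by
  refine ⟨?_, ?_⟩
  · simpa using h.2
  · simpa using h.1

/-! ### Deterministic analysis of a path that follows stacks. -/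

section Path

variable {ω : ℤ → ℕ → Bool} {X : ℕ → ℤ}

theorem visits_zero (X : ℕ → ℤ) (x : ℤ) : visits X 0 x = 0 := by simp [visits]

theorem visits_succ (X : ℕ → ℤ) (n : ℕ) (x : ℤ) :
    visits X (n + 1) x = visits X n x + if X n = x then 1 else 0 := by
  unfold visits
  rw [Finset.range_add_one, Finset.filter_insert]
  split_ifs <;> simp

theorem rightJumps_succ (X : ℕ → ℤ) (n : ℕ) (x : ℤ) :
    rightJumps X (n + 1) x = rightJumps X n x + if X n = x ∧ X (n + 1) = x + 1 then 1 else 0 := by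
  unfold rightJumps
  rw [Finset.range_add_one, Finset.filter_insert]
  split_ifs <;> simp

theorem leftJumps_succ (X : ℕ → ℤ) (n : ℕ) (x : ℤ) :
    leftJumps X (n + 1) x = leftJumps X n x + if X n = x ∧ X (n + 1) = x - 1 then 1 else 0 := by
  unfold leftJumps
  rw [Finset.range_add_one, Finset.filter_insert]
  split_ifs <;> simp

theorem Follows.rightJumps_eq (h : Follows ω X) (n : ℕ) (x : ℤ) :
    rightJumps X n x = heads (ω x) (visits X n x) := by
  induction n with
  | zero => simp [rightJumps, visits_zero, heads_zero]
  | succ n ih =>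
    rw [rightJumps_succ, visits_succ, ih, h.2 n]
    by_cases hx : X n = x
    · subst hx
      rw [if_pos rfl, heads_succ]
      cases ω (X n) (visits X n (X n)) <;> simp
      omega
    · simp [hx]

theorem Follows.leftJumps_add_rightJumps (h : Follows ω X) (n : ℕ) (x : ℤ) :
    leftJumps X n x + rightJumps X n x = visits X n x := by
  induction n with
  | zero => simp [rightJumps, leftJumps, visits_zero]
  | succ n ih =>
    rw [rightJumps_succ, leftJumps_succ, visits_succ, ← ih, h.2 n]
    by_cases hx : X n = x
    · subst hx
      have h1 : X n - 1 ≠ X n + 1 := by omega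
      have h2 : X n + 1 ≠ X n - 1 := by omega
      cases ω (X n) (visits X n (X n)) <;> simp [h1, h2] <;> omega
    · simp [hx]

theorem Follows.step (h : Follows ω X) (n : ℕ) : X (n + 1) = X n + 1 ∨ X (n + 1) = X n - 1 := by
  rw [h.2 n]; split_ifs <;> simp

/-- The path starts at or to the left of `x`, so its up- and down-crossings of the edge from `x` to
`x + 1` alternate, beginning with an up-crossing. -/
theorem Follows.crossing (h : Follows ω X) (n : ℕ) {x : ℤ} (hx : 0 ≤ x) :
    (rightJumps X n x : ℤ) = leftJumps X n (x + 1) + if x < X n then 1 else 0 := by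
  induction n with
  | zero => simp [rightJumps, leftJumps, h.1, not_lt.2 hx]
  | succ n ih =>
    rw [rightJumps_succ, leftJumps_succ]
    push_cast
    rw [ih]
    rcases h.step n with h1 | h1 <;> rw [h1] <;> split_ifs <;> omega

/-- To the left of the current position, the last jump from a visited site was to the right. -/
theorem Follows.last_arrow (h : Follows ω X) (n : ℕ) {x : ℤ} (hx : x < X n) {m : ℕ}
    (hm : visits X n x = m + 1) : ω x m = true := by
  induction n with
  | zero => simp [visits_zero] at hm
  | succ n ih =>
    rw [visits_succ] at hm
    by_cases h1 : X n = x
    · have hs := h.2 n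
      rw [if_pos h1] at hm
      rw [h1] at hs
      have : visits X n x = m := by omega
      rw [this] at hs
      by_contra hc
      rw [if_neg hc] at hs
      omega
    · rw [if_neg h1] at hm
      refine ih ?_ hm
      rcases h.step n with h2 | h2 <;> omega

/-- The edge balance gives one more right jump from `x` than left jumps from `x + 1`. The last arrow
used at `x` points right, so the arrows used there stop exactly at that `true`. -/
theorem Follows.leftJumps_eq_backJumps (h : Follows ω X) (n : ℕ) {x : ℤ} (hx0 : 0 ≤ x)
    (hx : x < X n) : leftJumps X n x = backJumps (ω x) (leftJumps X n (x + 1)) := by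
  have h1 := h.crossing n hx0
  rw [if_pos hx] at h1
  have h2 := h.leftJumps_add_rightJumps n x
  have h3 := h.rightJumps_eq n x
  obtain ⟨m, hm⟩ : ∃ m, visits X n x = m + 1 := ⟨visits X n x - 1, by omega⟩
  have h4 := h.last_arrow n hx hm
  rw [hm, heads_succ, if_pos h4] at h3
  have h5 : heads (ω x) m = leftJumps X n (x + 1) := by omega
  have h6 : Nat.nth (fun i => ω x i = true) (heads (ω x) m) = m := Nat.nth_count h4
  rw [backJumps, ← h5, h6]
  omega

theorem visits_eq_zero {n : ℕ} {x : ℤ} (h : ∀ k < n, X k ≠ x) : visits X n x = 0 := by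
  simpa [visits, Finset.filter_eq_empty_iff] using h

/-- Iterates the one-site recursion downwards from `K`, which has not been visited before `T` and
hence contributes `0` left jumps. -/
theorem Follows.chain_eq_leftJumps (h : Follows ω X) {T : ℕ} (K : ℕ) (hT : X T = K)
    (hlt : ∀ k < T, X k < K) : chain (fun x => ω x) K = leftJumps X T 0 := by
  have key : ∀ m ≤ K, chain (fun x => ω ((x : ℤ) + ((K - m : ℕ) : ℤ))) m
      = leftJumps X T ((K - m : ℕ) : ℤ) := by
    intro m hm
    induction m with
    | zero =>
      have h1 := h.leftJumps_add_rightJumps T K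
      rw [visits_eq_zero fun k hk => (hlt k hk).ne] at h1
      simp only [chain, Nat.sub_zero]
      omega
    | succ m ih =>
      have e : ((K - m : ℕ) : ℤ) = ((K - (m + 1) : ℕ) : ℤ) + 1 := by omega
      rw [h.leftJumps_eq_backJumps T (by omega) (by omega), ← e, ← ih (by omega), chain]
      congr 2
      · simp
      · funext x
        congr 1
        push_cast
        rw [e]
        ring
  simpa using key K le_rfl

theorem Follows.exists_first_hit (h : Follows ω X) {K n : ℕ} (hn : (K : ℤ) ≤ X n) :
    ∃ T, X T = K ∧ ∀ k < T, X k < K := by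
  classical
  have hex : ∃ n, (K : ℤ) ≤ X n := ⟨n, hn⟩
  refine ⟨Nat.find hex, ?_, fun k hk => not_le.1 (Nat.find_min hex hk)⟩
  have h1 := Nat.find_spec hex
  rcases hT : Nat.find hex with _ | T
  · rw [hT, h.1] at h1
    rw [h.1]; omega
  · have h2 := Nat.find_min hex (m := T) (by omega)
    rw [hT] at h1
    rcases h.step T with h3 | h3 <;> omega

theorem visits_eq_count (X : ℕ → ℤ) (n : ℕ) (x : ℤ) :
    visits X n x = Nat.count (fun k => X k = x) n := by
  rw [visits, Nat.count_eq_card_filter_range]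

theorem exists_visit (hx : ∃ᶠ n in atTop, X n = x) (i : ℕ) :
    ∃ k ≥ i, X k = x ∧ visits X k x = i := by
  have hinf : {k | X k = x}.Infinite := Nat.frequently_atTop_iff_infinite.1 hx
  refine ⟨Nat.nth (fun k => X k = x) i, ?_, Nat.nth_mem_of_infinite hinf i, ?_⟩
  · exact Nat.le_nth fun hf => absurd hf hinf
  · rw [visits_eq_count, Nat.count_nth_of_infinite hinf]

theorem Follows.frequently_right (h : Follows ω X) {x : ℤ} (hx : ∃ᶠ n in atTop, X n = x)
    (hω : IsMixed (ω x)) : ∃ᶠ n in atTop, X n = x + 1 := by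
  rw [frequently_atTop]
  intro N
  obtain ⟨i, hi, hN⟩ := hω.1.exists_gt N
  obtain ⟨k, hk, h1, h2⟩ := exists_visit hx i
  refine ⟨k + 1, by omega, ?_⟩
  have := h.2 k
  rwa [h1, h2, if_pos (show ω x i = true from hi)] at this

theorem Follows.frequently_left_jump (h : Follows ω X) {x : ℤ} (hx : ∃ᶠ n in atTop, X n = x)
    (hω : IsMixed (ω x)) : ∃ᶠ n in atTop, X n = x ∧ X (n + 1) = x - 1 := by
  rw [frequently_atTop]
  intro N
  obtain ⟨i, hi, hN⟩ := hω.2.exists_gt N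
  obtain ⟨k, hk, h1, h2⟩ := exists_visit hx i
  refine ⟨k, by omega, h1, ?_⟩
  have := h.2 k
  rwa [h1, h2, if_neg (by simp [show ω x i = false from hi])] at this

theorem Follows.frequently_left (h : Follows ω X) {x : ℤ} (hx : ∃ᶠ n in atTop, X n = x)
    (hω : IsMixed (ω x)) : ∃ᶠ n in atTop, X n = x - 1 := by
  have := h.frequently_left_jump hx hω
  rw [frequently_atTop] at this ⊢
  intro N
  obtain ⟨n, hn, h1⟩ := this N
  exact ⟨n + 1, by omega, h1.2⟩

theorem Follows.isRecurrentPath (h : Follows ω X) (hω : ∀ x, IsMixed (ω x)) {x : ℤ}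
    (hx : ∃ᶠ n in atTop, X n = x) : IsRecurrentPath X := by
  intro y
  induction y using Int.inductionOn' (b := x) with
  | zero => exact hx
  | succ k _ ih => exact h.frequently_right ih (hω k)
  | pred k _ ih => exact h.frequently_left ih (hω k)

/-- A site visited infinitely often would force recurrence, so each level is eventually avoided;
unit steps and integrality then raise the lower bound one level at a time. -/
theorem Follows.tendsto_atTop_of_pos (h : Follows ω X) (hω : ∀ x, IsMixed (ω x))
    (hr : ¬IsRecurrentPath X) {N : ℕ} (hN : ∀ n ≥ N, 0 < X n) : Tendsto X atTop atTop := by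
  have hfin : ∀ M : ℕ, ∀ᶠ n in atTop, (M : ℤ) < X n := by
    intro M
    induction M with
    | zero => exact eventually_atTop.2 ⟨N, by simpa using hN⟩
    | succ M ih =>
      have : ∀ᶠ n in atTop, X n ≠ (M + 1 : ℤ) := by
        by_contra hc
        exact hr (h.isRecurrentPath hω (x := M + 1) (by simpa [Filter.Frequently] using hc))
      filter_upwards [ih, this] with n h1 h2
      push_cast
      omega
  rw [tendsto_atTop]
  intro b
  filter_upwards [hfin b.toNat] with n hn
  omega

theorem visits_neg (X : ℕ → ℤ) (n : ℕ) (x : ℤ) : visits (fun k => -X k) n x = visits X n (-x) := by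
  unfold visits
  congr 1
  ext k
  simp [neg_eq_iff_eq_neg]

/-- Reflection symmetry, which reduces all statements about `-∞` to `+∞`. -/
theorem Follows.neg (h : Follows ω X) : Follows (fun x i => !ω (-x) i) fun n => -X n := by
  refine ⟨by simp [h.1], fun n => ?_⟩
  beta_reduce
  rw [visits_neg, neg_neg, h.2 n]
  cases ω (X n) (visits X n (X n)) <;> simp <;> ring

theorem isRecurrentPath_neg : IsRecurrentPath (fun n => -X n) ↔ IsRecurrentPath X := by
  constructor
  · intro h x
    simpa using h (-x)
  · intro h x
    simpa [neg_eq_iff_eq_neg] using h (-x)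

/-- A path following mixed stacks is recurrent or converges to `+∞` or to `-∞`. -/
theorem Follows.trichotomy (h : Follows ω X) (hω : ∀ x, IsMixed (ω x)) :
    IsRecurrentPath X ∨ Tendsto X atTop atTop ∨ Tendsto X atTop atBot := by
  by_cases hr : IsRecurrentPath X
  · exact Or.inl hr
  right
  have h0 : ∀ᶠ n in atTop, X n ≠ 0 := by
    by_contra hc
    exact hr (h.isRecurrentPath hω (x := 0) (by simpa [Filter.Frequently] using hc))
  obtain ⟨N, hN⟩ := eventually_atTop.1 h0
  -- With unit steps the path cannot change sign after its last visit to `0`.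
  rcases lt_or_gt_of_ne (hN N le_rfl) with hs | hs
  · right
    have hneg : ∀ n ≥ N, 0 < -X n := by
      intro n hn
      induction n, hn using Nat.le_induction with
      | base => omega
      | succ n hn ih =>
        have := hN (n + 1) (by omega)
        rcases h.step n with h3 | h3 <;> omega
    have := h.neg.tendsto_atTop_of_pos (fun x => (hω (-x)).not)
      (by rwa [isRecurrentPath_neg]) hneg
    exact tendsto_neg_atTop_iff.1 this
  · left
    have hpos : ∀ n ≥ N, 0 < X n := by
      intro n hn
      induction n, hn using Nat.le_induction with
      | base => omega
      | succ n hn ih =>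
        have := hN (n + 1) (by omega)
        rcases h.step n with h3 | h3 <;> omega
    exact h.tendsto_atTop_of_pos hω hr hpos

/-- Divergence to `+∞` leaves only finitely many left jumps from `0`, a bound on `chain` uniform in
the level. -/
theorem Follows.not_tendsto_atTop (h : Follows ω X)
    (hc : ∀ M, ∃ n, M < chain (fun x => ω x) n) : ¬Tendsto X atTop atTop := by
  intro ht
  obtain ⟨N, hN⟩ := eventually_atTop.1 (ht.eventually_gt_atTop 0)
  obtain ⟨K, hK⟩ := hc N
  obtain ⟨n, hn⟩ := (ht.eventually_ge_atTop (K : ℤ)).exists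
  obtain ⟨T, hT, hlt⟩ := h.exists_first_hit hn
  rw [h.chain_eq_leftJumps K hT hlt] at hK
  have : leftJumps X T 0 ≤ (Finset.range N).card := by
    refine Finset.card_le_card fun k hk => ?_
    simp only [Finset.mem_filter, Finset.mem_range] at hk ⊢
    by_contra hc
    have := hN k (by omega)
    omega
  simp at this
  omega

theorem Follows.not_isRecurrentPath (h : Follows ω X) (hω : ∀ x, IsMixed (ω x)) {M : ℕ}
    (hc : ∀ n, chain (fun x => ω x) n ≤ M) : ¬IsRecurrentPath X := by
  intro hr
  have hinf : {k | X k = 0 ∧ X (k + 1) = 0 - 1}.Infinite :=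
    Nat.frequently_atTop_iff_infinite.1 (h.frequently_left_jump (hr 0) (hω 0))
  obtain ⟨s, hs, hcard⟩ := hinf.exists_subset_card_eq (M + 1)
  obtain ⟨K, hK⟩ : ∃ K : ℕ, ∀ k ∈ s, k < K :=
    ⟨s.sup id + 1, fun k hk => Nat.lt_succ_of_le (Finset.le_sup (f := id) hk)⟩
  obtain ⟨n, hn⟩ := (hr K).exists
  obtain ⟨T, hT, hlt⟩ := h.exists_first_hit hn.ge
  -- Reaching level `K` by unit steps takes at least `K` steps, so all `M + 1` selected left jumps
  -- precede `T`.
  have hKT : K ≤ T := by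
    have : ∀ n : ℕ, X n ≤ n := by
      intro n
      induction n with
      | zero => simp [h.1]
      | succ n ih => rcases h.step n with h3 | h3 <;> push_cast <;> omega
    have := this T
    omega
  have h1 := hc K
  rw [h.chain_eq_leftJumps K hT hlt] at h1
  have : s.card ≤ leftJumps X T 0 := by
    refine Finset.card_le_card fun k hk => ?_
    have := hs (Finset.mem_coe.2 hk)
    have := hK k hk
    simp only [Finset.mem_filter, Finset.mem_range]
    exact ⟨by omega, hs (Finset.mem_coe.2 hk)⟩
  omega

theorem Follows.not_tendsto_atBot (h : Follows ω X)
    (hc : ∀ M, ∃ n, M < chain (fun x i => !ω (-x) i) n) : ¬Tendsto X atTop atBot := fun ht =>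
  h.neg.not_tendsto_atTop hc (tendsto_neg_atTop_iff.2 ht)

theorem Follows.isRecurrentPath_of_chain (h : Follows ω X) (hω : ∀ x, IsMixed (ω x))
    (hr : ∀ M, ∃ n, M < chain (fun x => ω x) n)
    (hl : ∀ M, ∃ n, M < chain (fun x i => !ω (-x) i) n) : IsRecurrentPath X := by
  rcases h.trichotomy hω with h1 | h1 | h1
  · exact h1
  · exact absurd h1 (h.not_tendsto_atTop hr)
  · exact absurd h1 (h.not_tendsto_atBot hl)

theorem Follows.isTransientPath_of_chain (h : Follows ω X) (hω : ∀ x, IsMixed (ω x)) {M : ℕ}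
    (hr : ∀ n, chain (fun x => ω x) n ≤ M) : IsTransientPath X := by
  rcases h.trichotomy hω with h1 | h1
  · exact absurd h1 (h.not_isRecurrentPath hω hr)
  · exact h1

end Path

/-! ### Laws of urn draws and their construction from uniform variables. -/

/-- The law of the successive draws of an urn in which the draw number `i`, made after `c` draws
of `true`, is `true` with probability `p c i`. -/
def IsUrnLaw (p : ℕ → ℕ → ℝ) (ν : Measure (ℕ → Bool)) : Prop :=
  ∀ (b : ℕ → Bool) (j : ℕ), ν {a | ∀ i < j + 1, a i = b i} =
    ENNReal.ofReal (if b j then p (heads b j) j else 1 - p (heads b j) j) *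
      ν {a | ∀ i < j, a i = b i}

/-- Extension of a finite sequence by `false`. -/
def extendBool {m : ℕ} (b : Fin m → Bool) (i : ℕ) : Bool :=
  if h : i < m then b ⟨i, h⟩ else false

theorem measurableSet_prefix (b : ℕ → Bool) (j : ℕ) :
    MeasurableSet {a : ℕ → Bool | ∀ i < j, a i = b i} := by
  have : {a : ℕ → Bool | ∀ i < j, a i = b i} = ⋂ i, ⋂ _ : i < j, (fun a => a i) ⁻¹' {b i} := by
    ext; simp
  rw [this]
  exact MeasurableSet.iInter fun i => MeasurableSet.iInter fun _ =>
    measurable_pi_apply i (measurableSet_singleton _)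

theorem lintegral_prefix (ν : Measure (ℕ → Bool)) {m : ℕ} {Φ : (ℕ → Bool) → ENNReal}
    (hΦ : ∀ a b : ℕ → Bool, (∀ i < m, a i = b i) → Φ a = Φ b) :
    ∫⁻ a, Φ a ∂ν = ∑ b : Fin m → Bool, Φ (extendBool b) * ν {a | ∀ i < m, a i = extendBool b i} := by
  have hr : Measurable fun (a : ℕ → Bool) (i : Fin m) => a i := by fun_prop
  have h1 : ∀ a, Φ a = (fun b : Fin m → Bool => Φ (extendBool b)) fun i => a i := fun a =>
    hΦ _ _ fun i hi => by simp [extendBool, hi]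
  rw [lintegral_congr h1, ← lintegral_map (μ := ν) (f := fun b : Fin m → Bool => Φ (extendBool b))
    (measurable_of_finite _) hr, lintegral_fintype]
  refine Finset.sum_congr rfl fun b _ => ?_
  rw [Measure.map_apply hr (measurableSet_singleton _)]
  congr 2
  ext a
  simp only [mem_preimage, mem_singleton_iff, mem_ofPred_eq, funext_iff]
  constructor
  · intro h i hi
    simp [extendBool, hi, ← h ⟨i, hi⟩]
  · intro h i
    simpa [extendBool] using h i i.2

/-- The conditional law of a draw, given the number of `true`s before it. -/
theorem IsUrnLaw.lintegral {p : ℕ → ℕ → ℝ} {ν : Measure (ℕ → Bool)} (hν : IsUrnLaw p ν) (j : ℕ)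
    (G : ℕ → Bool → ENNReal) :
    ∫⁻ a, G (heads a j) (a j) ∂ν =
      ∫⁻ a, (ENNReal.ofReal (p (heads a j) j) * G (heads a j) true +
        ENNReal.ofReal (1 - p (heads a j) j) * G (heads a j) false) ∂ν := by
  rw [lintegral_prefix ν (m := j + 1), lintegral_prefix ν (m := j)]
  -- Words of length `j + 1` are split into a word of length `j` and a last letter, whose two values
  -- give the two terms.
  · rw [← (Fin.snocEquiv fun _ => Bool).sum_comp, Fintype.sum_prod_type, Fintype.sum_bool,
      ← Finset.sum_add_distrib]
    refine Finset.sum_congr rfl fun b _ => ?_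
    have key : ∀ x : Bool,
        extendBool (Fin.snoc b x : Fin (j + 1) → Bool) j = x ∧
        ∀ i < j, extendBool (Fin.snoc b x : Fin (j + 1) → Bool) i = extendBool b i := by
      refine fun x => ⟨?_, fun i hi => ?_⟩
      · simp [extendBool, Fin.snoc]
      · simp [extendBool, Fin.snoc, hi, Nat.lt_succ_of_lt hi]
    have hset : ∀ x : Bool,
        {a : ℕ → Bool | ∀ i < j, a i = extendBool (Fin.snoc b x : Fin (j + 1) → Bool) i} =
        {a | ∀ i < j, a i = extendBool b i} := by
      intro x
      ext a
      exact forall₂_congr fun i hi => by rw [(key x).2 i hi]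
    simp only [Fin.snocEquiv, Equiv.coe_fn_mk]
    rw [hν, hν, hset, hset, heads_congr (key true).2, heads_congr (key false).2, (key true).1,
      (key false).1]
    simp only [if_true, Bool.false_eq_true, if_false]
    ring
  · intro a b h
    rw [heads_congr h]
  · intro a b h
    rw [heads_congr fun i hi => h i (by omega), h j (by omega)]

/-- The number of `true`s among the first draws of the urn driven by `u`. -/
noncomputable def urnHeads (p : ℕ → ℕ → ℝ) (u : ℕ → unitInterval) : ℕ → ℕ
  | 0 => 0
  | i + 1 => urnHeads p u i + if (u i : ℝ) ≤ p (urnHeads p u i) i then 1 else 0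

/-- The draws of the urn driven by `u`: the draw number `i` is `true` if and only if `u i` is at
most the probability of `true`. -/
noncomputable def urnDraws (p : ℕ → ℕ → ℝ) (u : ℕ → unitInterval) (i : ℕ) : Bool :=
  decide ((u i : ℝ) ≤ p (urnHeads p u i) i)

/-- The law of the draws of the urn with probabilities `p`. -/
noncomputable def urnLaw (p : ℕ → ℕ → ℝ) : Measure (ℕ → Bool) :=
  (Measure.infinitePi fun _ : ℕ => (volume : Measure unitInterval)).map (urnDraws p)

theorem heads_urnDraws (p : ℕ → ℕ → ℝ) (u : ℕ → unitInterval) (i : ℕ) :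
    heads (urnDraws p u) i = urnHeads p u i := by
  induction i with
  | zero => simp [heads_zero, urnHeads]
  | succ i ih => simp [heads_succ, urnHeads, ih, urnDraws]

theorem measurable_urnHeads (p : ℕ → ℕ → ℝ) (i : ℕ) : Measurable fun u => urnHeads p u i := by
  induction i with
  | zero => exact measurable_const
  | succ i ih =>
    refine ih.add (Measurable.ite (measurableSet_le (by fun_prop) ?_) measurable_const
      measurable_const)
    exact (measurable_of_countable fun c => p c i).comp ih

theorem measurable_urnDraws (p : ℕ → ℕ → ℝ) : Measurable (urnDraws p) := by
  refine measurable_pi_lambda _ fun i => measurable_to_bool ?_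
  have : (fun u => urnDraws p u i) ⁻¹' {true} = {u | (u i : ℝ) ≤ p (urnHeads p u i) i} := by
    ext; simp [urnDraws]
  rw [this]
  exact measurableSet_le (by fun_prop)
    ((measurable_of_countable fun c => p c i).comp (measurable_urnHeads p i))

instance (p : ℕ → ℕ → ℝ) : IsProbabilityMeasure (urnLaw p) :=
  Measure.isProbabilityMeasure_map (measurable_urnDraws p).aemeasurable

theorem urnDraws_prefix_iff (p : ℕ → ℕ → ℝ) (u : ℕ → unitInterval) (b : ℕ → Bool) (j : ℕ) :
    (∀ i < j, urnDraws p u i = b i) ↔ ∀ i < j, decide ((u i : ℝ) ≤ p (heads b i) i) = b i := by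
  induction j with
  | zero => simp
  | succ j ih =>
    simp only [Nat.forall_lt_succ_right]
    rw [ih]
    refine and_congr_right fun h => ?_
    rw [urnDraws, ← heads_urnDraws, heads_congr (ih.2 h)]

theorem urnLaw_prefix {p : ℕ → ℕ → ℝ} (hp : ∀ c i, p c i ∈ Icc (0 : ℝ) 1) (b : ℕ → Bool) (j : ℕ) :
    urnLaw p {a | ∀ i < j, a i = b i} =
      ∏ i ∈ Finset.range j,
        ENNReal.ofReal (if b i then p (heads b i) i else 1 - p (heads b i) i) := by
  rw [urnLaw, Measure.map_apply (measurable_urnDraws p) (measurableSet_prefix b j)]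
  have h1 : urnDraws p ⁻¹' {a | ∀ i < j, a i = b i} = Set.pi (Finset.range j : Finset ℕ)
      fun i => if b i then Iic ⟨p (heads b i) i, hp _ _⟩ else Ioi ⟨p (heads b i) i, hp _ _⟩ := by
    ext u
    simp only [mem_preimage, mem_ofPred_eq, urnDraws_prefix_iff, Set.mem_pi, Finset.coe_range,
      mem_Iio]
    refine forall₂_congr fun i _ => ?_
    cases b i
    · simp only [decide_eq_false_iff_not, not_le, Bool.false_eq_true, if_false, mem_Ioi]
      exact Iff.rfl
    · simp only [decide_eq_true_eq, if_true, mem_Iic]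
      exact Iff.rfl
  rw [h1, Measure.infinitePi_pi]
  · refine Finset.prod_congr rfl fun i _ => ?_
    cases b i <;> simp
  · intro i _
    split_ifs
    · exact measurableSet_Iic
    · exact measurableSet_Ioi

theorem isUrnLaw_urnLaw {p : ℕ → ℕ → ℝ} (hp : ∀ c i, p c i ∈ Icc (0 : ℝ) 1) :
    IsUrnLaw p (urnLaw p) := by
  intro b j
  rw [urnLaw_prefix hp, urnLaw_prefix hp, Finset.prod_range_succ, mul_comm]

/-- The second Borel–Cantelli lemma for independent uniform variables. -/
theorem ae_infinite_mem {s : Set unitInterval} (hs : MeasurableSet s) (h0 : volume s ≠ 0) :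
    ∀ᵐ u ∂(Measure.infinitePi fun _ : ℕ => (volume : Measure unitInterval)),
      {i | u i ∈ s}.Infinite := by
  set P := Measure.infinitePi fun _ : ℕ => (volume : Measure unitInterval)
  have hmeas : ∀ i : ℕ, MeasurableSet {u : ℕ → unitInterval | u i ∈ s} := fun i =>
    measurable_pi_apply i hs
  have hind : iIndepSet (fun i : ℕ => {u : ℕ → unitInterval | u i ∈ s}) P := by
    have h1 : iIndepFun (fun (i : ℕ) (u : ℕ → unitInterval) => u i) P :=
      iIndepFun_infinitePi (X := fun _ x => x) fun _ => measurable_id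
    rw [iIndepSet_iff_meas_biInter hmeas]
    intro t
    exact h1.measure_inter_preimage_eq_mul t (sets := fun _ => s) fun _ _ => hs
  have hval : ∀ i : ℕ, P {u : ℕ → unitInterval | u i ∈ s} = volume s := fun i =>
    (measurePreserving_eval_infinitePi (fun _ : ℕ => (volume : Measure unitInterval))
      i).measure_preimage hs.nullMeasurableSet
  have h1 := measure_limsup_eq_one hmeas hind (by
    simp only [hval]
    exact ENNReal.tsum_const_eq_top_of_ne_zero h0)
  have h2 : ∀ᵐ u ∂P, u ∈ limsup (fun i : ℕ => {u : ℕ → unitInterval | u i ∈ s}) atTop :=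
    (prob_compl_eq_zero_iff (MeasurableSet.measurableSet_limsup hmeas)).2 h1
  filter_upwards [h2] with u hu
  rw [mem_limsup_iff_frequently_mem, Nat.frequently_atTop_iff_infinite] at hu
  exact hu

theorem measurableSet_apply_eq (i : ℕ) (x : Bool) : MeasurableSet {a : ℕ → Bool | a i = x} :=
  measurableSet_eq_fun (measurable_pi_apply i) measurable_const

theorem measurableSet_isMixed : MeasurableSet {a : ℕ → Bool | IsMixed a} := by
  have h : ∀ x : Bool, MeasurableSet {a : ℕ → Bool | {i | a i = x}.Infinite} := by
    intro x
    have : {a : ℕ → Bool | {i | a i = x}.Infinite} =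
        limsup (fun i : ℕ => {a : ℕ → Bool | a i = x}) atTop := by
      ext a
      rw [mem_limsup_iff_frequently_mem, Nat.frequently_atTop_iff_infinite]
      rfl
    rw [this]
    exact MeasurableSet.measurableSet_limsup fun i => measurableSet_apply_eq i x
  exact (h true).inter (h false)

theorem ae_isMixed_urnLaw {p : ℕ → ℕ → ℝ} {q : ℝ} (hq0 : 0 < q) (hq : ∀ c i, q ≤ p c i)
    (hq' : ∀ c i, p c i ≤ 1 - q) : ∀ᵐ a ∂urnLaw p, IsMixed a := by
  rw [urnLaw, ae_map_iff (measurable_urnDraws p).aemeasurable measurableSet_isMixed]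
  have hq2 : q ≤ 1 - q := (hq 0 0).trans (hq' 0 0)
  -- Whatever the past, a uniform variable at most `q` forces `true` and one above `1 - q` forces
  -- `false`.
  filter_upwards [ae_infinite_mem (s := Iic ⟨q, by constructor <;> linarith⟩) measurableSet_Iic
      (by simpa using hq0), ae_infinite_mem (s := Ioi ⟨1 - q, by constructor <;> linarith⟩)
      measurableSet_Ioi (by simpa using hq0)] with u h1 h2
  refine ⟨h1.mono fun i hi => ?_, h2.mono fun i hi => ?_⟩
  · have : (u i : ℝ) ≤ q := hi
    simpa [urnDraws] using this.trans (hq _ _)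
  · have : 1 - q < (u i : ℝ) := hi
    simpa [urnDraws] using (hq' _ _).trans_lt this

theorem measurable_heads (n : ℕ) : Measurable fun a => heads a n := by
  induction n with
  | zero => simp [heads_zero]
  | succ n ih =>
    simp only [heads_succ]
    exact ih.add (Measurable.ite (measurableSet_apply_eq n true)
      measurable_const measurable_const)

/-- Exchanging `true` and `false` in the draws of an urn. -/
theorem IsUrnLaw.map_not {p : ℕ → ℕ → ℝ} {ν : Measure (ℕ → Bool)} (hν : IsUrnLaw p ν) :
    IsUrnLaw (fun c i => 1 - p (i - c) i) (ν.map fun a i => !a i) := by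
  have hm : Measurable fun (a : ℕ → Bool) (i : ℕ) => !a i :=
    measurable_pi_lambda _ fun i => (measurable_of_finite not).comp (measurable_pi_apply i)
  have h1 : ∀ (b : ℕ → Bool) (j : ℕ), (fun (a : ℕ → Bool) (i : ℕ) => !a i) ⁻¹'
      {a | ∀ i < j, a i = b i} = {a | ∀ i < j, a i = !b i} := by
    intro b j
    ext a
    simp only [mem_preimage, mem_ofPred_eq]
    exact forall₂_congr fun i _ => by cases a i <;> cases b i <;> simp
  intro b j
  rw [Measure.map_apply hm (measurableSet_prefix _ _),
    Measure.map_apply hm (measurableSet_prefix _ _), h1, h1, hν, heads_not]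
  congr 2
  cases b j <;> simp

/-! ### The walk reading random stacks has the law of the reinforced walk. -/

/-- The position and the numbers of past visits of the walk that follows the stacks `ω`. -/
def walkState (ω : ℤ → ℕ → Bool) : ℕ → ℤ × (ℤ → ℕ)
  | 0 => (0, fun _ => 0)
  | n + 1 =>
    let s := walkState ω n
    (if ω s.1 (s.2 s.1) then s.1 + 1 else s.1 - 1, Function.update s.2 s.1 (s.2 s.1 + 1))

/-- The walk that follows the stacks `ω`. -/
def walk (ω : ℤ → ℕ → Bool) (n : ℕ) : ℤ := (walkState ω n).1

theorem walkState_snd (ω : ℤ → ℕ → Bool) (n : ℕ) (x : ℤ) :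
    (walkState ω n).2 x = visits (walk ω) n x := by
  induction n generalizing x with
  | zero => simp [walkState, visits_zero]
  | succ n ih =>
    rw [visits_succ, ← ih, walkState]
    by_cases hx : walk ω n = x
    · subst hx
      simp [walk]
    · rw [if_neg hx, add_zero]
      exact Function.update_of_ne (Ne.symm hx) _ _

theorem follows_walk (ω : ℤ → ℕ → Bool) : Follows ω (walk ω) := by
  refine ⟨rfl, fun n => ?_⟩
  rw [← walkState_snd]
  rfl

theorem visits_congr {X Y : ℕ → ℤ} {n : ℕ} (h : ∀ k < n, X k = Y k) (x : ℤ) :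
    visits X n x = visits Y n x := by
  unfold visits
  congr 1
  exact Finset.filter_congr fun k hk => by rw [h k (Finset.mem_range.1 hk)]

theorem rightJumps_congr {X Y : ℕ → ℤ} {n : ℕ} (h : ∀ k ≤ n, X k = Y k) (x : ℤ) :
    rightJumps X n x = rightJumps Y n x := by
  unfold rightJumps
  congr 1
  refine Finset.filter_congr fun k hk => ?_
  have := Finset.mem_range.1 hk
  rw [h k (by omega), h (k + 1) (by omega)]

/-- The first `n` steps read exactly the first `visits X n x` entries of each stack `x`. Events
about finite paths thus become cylinder events for the stacks. -/
theorem Follows.prefix_eq_iff {ω ω' : ℤ → ℕ → Bool} {X Y : ℕ → ℤ} (hX : Follows ω X)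
    (hY : Follows ω' Y) (n : ℕ) :
    (∀ k ≤ n, Y k = X k) ↔ ∀ x, ∀ i < visits X n x, ω' x i = ω x i := by
  induction n with
  | zero => simp [visits_zero, hX.1, hY.1]
  | succ n ih =>
    have hsplit : (∀ k ≤ n + 1, Y k = X k) ↔ (∀ k ≤ n, Y k = X k) ∧ Y (n + 1) = X (n + 1) := by
      simp only [Nat.le_succ_iff]
      constructor
      · exact fun h => ⟨fun k hk => h k (Or.inl hk), h _ (Or.inr rfl)⟩
      · rintro ⟨h1, h2⟩ k (hk | rfl)
        · exact h1 k hk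
        · exact h2
    have hsplit' : (∀ x, ∀ i < visits X (n + 1) x, ω' x i = ω x i) ↔
        (∀ x, ∀ i < visits X n x, ω' x i = ω x i) ∧
          ω' (X n) (visits X n (X n)) = ω (X n) (visits X n (X n)) := by
      simp only [visits_succ]
      constructor
      · exact fun h => ⟨fun x i hi => h x i (by omega), h _ _ (by simp)⟩
      · rintro ⟨h1, h2⟩ x i hi
        by_cases hx : X n = x
        · subst hx
          rw [if_pos rfl] at hi
          rcases Nat.lt_succ_iff_lt_or_eq.1 hi with h | rfl
          · exact h1 _ _ h
          · exact h2
        · rw [if_neg hx, add_zero] at hi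
          exact h1 x i hi
    rw [hsplit, hsplit', ← ih]
    refine and_congr_right fun h => ?_
    rw [hX.2, hY.2, visits_congr fun k hk => h k hk.le, h n le_rfl]
    cases ω' (X n) (visits X n (X n)) <;> cases ω (X n) (visits X n (X n)) <;> simp
    all_goals omega

theorem measurableSet_stack_prefix (v : ℤ → ℕ) (b : ℤ → ℕ → Bool) :
    MeasurableSet {ω : ℤ → ℕ → Bool | ∀ x, ∀ i < v x, ω x i = b x i} := by
  have : {ω : ℤ → ℕ → Bool | ∀ x, ∀ i < v x, ω x i = b x i} =
      ⋂ x, (fun ω => ω x) ⁻¹' {a | ∀ i < v x, a i = b x i} := by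
    ext; simp
  rw [this]
  exact MeasurableSet.iInter fun x => measurable_pi_apply x (measurableSet_prefix _ _)

theorem measurableSet_walk_prefix (n : ℕ) (h : ℕ → ℤ) :
    MeasurableSet {ω | ∀ k ≤ n, walk ω k = h k} := by
  rcases Set.eq_empty_or_nonempty {ω | ∀ k ≤ n, walk ω k = h k} with he | ⟨ω₀, h0⟩
  · rw [he]; exact MeasurableSet.empty
  · have : {ω | ∀ k ≤ n, walk ω k = h k} =
        {ω | ∀ x, ∀ i < visits (walk ω₀) n x, ω x i = ω₀ x i} := by
      ext ω
      rw [mem_ofPred_eq, mem_ofPred_eq, ← (follows_walk ω₀).prefix_eq_iff (follows_walk ω)]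
      exact forall₂_congr fun k hk => by rw [h0 k hk]
    rw [this]
    exact measurableSet_stack_prefix _ _

theorem measurable_walk : Measurable walk := by
  refine measurable_pi_lambda _ fun n => ?_
  have h1 : Measurable fun ω (k : Finset.Iic n) => walk ω k := by
    refine measurable_to_countable' fun h => ?_
    have : (fun ω (k : Finset.Iic n) => walk ω k) ⁻¹' {h} =
        {ω | ∀ k ≤ n, walk ω k = extendPath h k} := by
      ext ω
      simp only [mem_preimage, mem_singleton_iff, mem_ofPred_eq, funext_iff]
      constructor
      · intro hk k hkn
        rw [extendPath, dif_pos hkn, ← hk ⟨k, Finset.mem_Iic.2 hkn⟩]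
      · rintro hk ⟨k, hkn⟩
        rw [hk k (Finset.mem_Iic.1 hkn), extendPath, dif_pos (Finset.mem_Iic.1 hkn)]
    rw [this]
    exact measurableSet_walk_prefix _ _
  exact (measurable_pi_apply (⟨n, Finset.mem_Iic.2 le_rfl⟩ : Finset.Iic n)).comp h1

theorem infinitePi_stack_prefix (ν : Measure (ℕ → Bool)) [IsProbabilityMeasure ν] (s : Finset ℤ)
    (v : ℤ → ℕ) (b : ℤ → ℕ → Bool) (hs : ∀ x ∉ s, v x = 0) :
    Measure.infinitePi (fun _ : ℤ => ν) {ω | ∀ x, ∀ i < v x, ω x i = b x i} =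
      ∏ x ∈ s, ν {a | ∀ i < v x, a i = b x i} := by
  rw [← Measure.infinitePi_pi (μ := fun _ : ℤ => ν) fun x _ => measurableSet_prefix (b x) (v x)]
  congr 1
  ext ω
  simp only [mem_ofPred_eq, Set.mem_pi, Finset.mem_coe]
  refine ⟨fun h x _ => h x, fun h x => ?_⟩
  by_cases hx : x ∈ s
  · exact h x hx
  · simp [hs x hx]

/-- The conditional law of a step of the walk that follows random stacks. -/
theorem infinitePi_walk_succ {p : ℕ → ℕ → ℝ} {ν : Measure (ℕ → Bool)} [IsProbabilityMeasure ν]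
    (hν : IsUrnLaw p ν) (n : ℕ) (h : ℕ → ℤ) :
    Measure.infinitePi (fun _ : ℤ => ν) {ω | ∀ k ≤ n + 1, walk ω k = h k} =
      Measure.infinitePi (fun _ : ℤ => ν) {ω | ∀ k ≤ n, walk ω k = h k} *
        (ENNReal.ofReal (p (rightJumps h n (h n)) (visits h n (h n))) *
            (if h (n + 1) = h n + 1 then 1 else 0) +
          ENNReal.ofReal (1 - p (rightJumps h n (h n)) (visits h n (h n))) *
            (if h (n + 1) = h n - 1 then 1 else 0)) := by
  set P := Measure.infinitePi (fun _ : ℤ => ν)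
  rcases Set.eq_empty_or_nonempty {ω | ∀ k ≤ n, walk ω k = h k} with he | ⟨ω₀, h0⟩
  · have : {ω | ∀ k ≤ n + 1, walk ω k = h k} ⊆ {ω | ∀ k ≤ n, walk ω k = h k} :=
      fun ω hω k hk => hω k (by omega)
    rw [he] at this ⊢
    rw [subset_empty_iff.1 this]
    simp
  set v := visits h n with hv
  have hvis : ∀ x, visits (walk ω₀) n x = v x := fun x => visits_congr (fun k hk => h0 k hk.le) x
  have hheads : heads (ω₀ (h n)) (v (h n)) = rightJumps h n (h n) := by
    rw [← rightJumps_congr h0, (follows_walk ω₀).rightJumps_eq, hvis]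
  have hE : ∀ ω, (∀ k ≤ n, walk ω k = h k) ↔ ∀ x, ∀ i < v x, ω x i = ω₀ x i := by
    intro ω
    simp only [← hvis]
    rw [← (follows_walk ω₀).prefix_eq_iff (follows_walk ω)]
    exact forall₂_congr fun k hk => by rw [h0 k hk]
  set s : Finset ℤ := insert (h n) ((Finset.range n).image h) with hs
  have hvs : ∀ x ∉ s, v x = 0 := fun x hx => visits_eq_zero fun k hk hc => hx <| by
    simp only [hs, Finset.mem_insert, Finset.mem_image, Finset.mem_range]
    exact Or.inr ⟨k, hk, hc⟩
  have hbase : P {ω | ∀ k ≤ n, walk ω k = h k} = ∏ x ∈ s, ν {a | ∀ i < v x, a i = ω₀ x i} := by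
    rw [← infinitePi_stack_prefix ν s v ω₀ hvs]
    congr 1
    ext ω
    exact hE ω
  have hnext : ∀ y : Bool, P ({ω | ∀ k ≤ n, walk ω k = h k} ∩ {ω | ω (h n) (v (h n)) = y}) =
      P {ω | ∀ k ≤ n, walk ω k = h k} * ENNReal.ofReal
        (if y then p (rightJumps h n (h n)) (v (h n))
          else 1 - p (rightJumps h n (h n)) (v (h n))) := by
    intro y
    -- One further entry is prescribed, in the stack of the current site only; the other factors of
    -- the product are unchanged.
    set b : ℕ → Bool := Function.update (ω₀ (h n)) (v (h n)) y with hb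
    have hb1 : ∀ i < v (h n), b i = ω₀ (h n) i := fun i hi =>
      Function.update_of_ne (by omega) _ _
    have hset : {ω | ∀ k ≤ n, walk ω k = h k} ∩ {ω | ω (h n) (v (h n)) = y} =
        {ω | ∀ x, ∀ i < Function.update v (h n) (v (h n) + 1) x,
          ω x i = Function.update ω₀ (h n) b x i} := by
      ext ω
      rw [mem_inter_iff, mem_ofPred_eq, mem_ofPred_eq, mem_ofPred_eq, hE]
      constructor
      · rintro ⟨h1, h2⟩ x i hi
        by_cases hx : x = h n
        · subst hx
          rw [Function.update_self] at hi ⊢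
          rcases Nat.lt_succ_iff_lt_or_eq.1 hi with h3 | rfl
          · rw [h1 _ _ h3, hb1 i h3]
          · rw [h2, hb, Function.update_self]
        · rw [Function.update_of_ne hx] at hi ⊢
          exact h1 x i hi
      · intro h1
        refine ⟨fun x i hi => ?_, ?_⟩
        · by_cases hx : x = h n
          · subst hx
            have := h1 (h n) i (by rw [Function.update_self]; omega)
            rwa [Function.update_self, hb1 i hi] at this
          · have := h1 x i (by rwa [Function.update_of_ne hx])
            rwa [Function.update_of_ne hx] at this
        · have := h1 (h n) (v (h n)) (by rw [Function.update_self]; omega)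
          rwa [Function.update_self, hb, Function.update_self] at this
    rw [hset, infinitePi_stack_prefix ν s, hbase,
      ← Finset.mul_prod_erase s _ (Finset.mem_insert_self _ _),
      ← Finset.mul_prod_erase s (fun x => ν {a | ∀ i < v x, a i = ω₀ x i})
        (Finset.mem_insert_self _ _), Function.update_self, Function.update_self, hν]
    · have e1 : heads b (v (h n)) = rightJumps h n (h n) := by rw [heads_congr hb1, hheads]
      have e2 : {a : ℕ → Bool | ∀ i < v (h n), a i = b i} =
          {a | ∀ i < v (h n), a i = ω₀ (h n) i} := by
        ext a
        exact forall₂_congr fun i hi => by rw [hb1 i hi]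
      have e3 : b (v (h n)) = y := Function.update_self _ _ _
      have e4 : ∏ x ∈ s.erase (h n), ν {a | ∀ i < Function.update v (h n) (v (h n) + 1) x,
          a i = Function.update ω₀ (h n) b x i} =
          ∏ x ∈ s.erase (h n), ν {a | ∀ i < v x, a i = ω₀ x i} :=
        Finset.prod_congr rfl fun x hx => by
          rw [Function.update_of_ne (Finset.ne_of_mem_erase hx),
            Function.update_of_ne (Finset.ne_of_mem_erase hx)]
      rw [e1, e2, e3, e4]
      ring
    · intro x hx
      rw [Function.update_of_ne, hvs x hx]
      rintro rfl
      exact hx (Finset.mem_insert_self _ _)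
  have hstep : ∀ ω, (∀ k ≤ n + 1, walk ω k = h k) ↔ (∀ k ≤ n, walk ω k = h k) ∧
      h (n + 1) = if ω (h n) (v (h n)) then h n + 1 else h n - 1 := by
    intro ω
    constructor
    · intro hω
      have h1 : ∀ k ≤ n, walk ω k = h k := fun k hk => hω k (by omega)
      refine ⟨h1, ?_⟩
      rw [← hω (n + 1) le_rfl, (follows_walk ω).2, visits_congr fun k hk => h1 k hk.le,
        h1 n le_rfl]
    · rintro ⟨h1, h2⟩ k hk
      rcases Nat.le_succ_iff.1 hk with h3 | rfl
      · exact h1 k h3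
      · rw [h2, (follows_walk ω).2, visits_congr fun k hk => h1 k hk.le, h1 n le_rfl]
  by_cases hr : h (n + 1) = h n + 1
  · have hl : h (n + 1) ≠ h n - 1 := by omega
    rw [if_pos hr, if_neg hl]
    have : {ω | ∀ k ≤ n + 1, walk ω k = h k} =
        {ω | ∀ k ≤ n, walk ω k = h k} ∩ {ω | ω (h n) (v (h n)) = true} := by
      ext ω
      rw [mem_inter_iff, mem_ofPred_eq, mem_ofPred_eq, mem_ofPred_eq, hstep]
      refine and_congr_right fun _ => ?_
      cases ω (h n) (v (h n)) <;> simp [hr]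
      omega
    rw [this, hnext]
    simp
  · by_cases hl : h (n + 1) = h n - 1
    · rw [if_neg hr, if_pos hl]
      have : {ω | ∀ k ≤ n + 1, walk ω k = h k} =
          {ω | ∀ k ≤ n, walk ω k = h k} ∩ {ω | ω (h n) (v (h n)) = false} := by
        ext ω
        rw [mem_inter_iff, mem_ofPred_eq, mem_ofPred_eq, mem_ofPred_eq, hstep]
        refine and_congr_right fun _ => ?_
        cases ω (h n) (v (h n)) <;> simp [hl]
        omega
      rw [this, hnext]
      simp
    · have : {ω | ∀ k ≤ n + 1, walk ω k = h k} = ∅ := by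
        rw [Set.eq_empty_iff_forall_notMem]
        intro ω hω
        rw [mem_ofPred_eq, hstep] at hω
        have := hω.2
        split_ifs at this <;> omega
      rw [this]
      simp [hr, hl]

theorem trajMeasure_prefix_succ {μ₀ : Measure ℤ} [IsProbabilityMeasure μ₀]
    (κ : (n : ℕ) → Kernel (Finset.Iic n → ℤ) ℤ) [∀ n, IsMarkovKernel (κ n)] (n : ℕ) (h : ℕ → ℤ) :
    Kernel.trajMeasure (X := fun _ => ℤ) μ₀ κ {X | ∀ k ≤ n + 1, X k = h k} =
      Kernel.trajMeasure (X := fun _ => ℤ) μ₀ κ {X | ∀ k ≤ n, X k = h k} *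
        κ n (fun k => h k) {h (n + 1)} := by
  have hkey := Kernel.map_frestrictLe_trajMeasure_compProd_eq_map_trajMeasure
    (X := fun _ => ℤ) (κ := κ) (μ₀ := μ₀) (a := n)
  have h1 := congrArg (fun m => m ({fun k : Finset.Iic n => h k} ×ˢ {h (n + 1)})) hkey
  rw [Measure.compProd_apply_prod (measurableSet_singleton _) (measurableSet_singleton _),
    Measure.restrict_singleton, lintegral_smul_measure, lintegral_dirac,
    Measure.map_apply (by fun_prop) (measurableSet_singleton _), Measure.map_apply (by fun_prop)
      ((measurableSet_singleton _).prod (measurableSet_singleton _))] at h1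
  have hmem : ∀ X : ℕ → ℤ, Preorder.frestrictLe (π := fun _ => ℤ) n X = (fun k : Finset.Iic n => h k) ↔
      ∀ k ≤ n, X k = h k := by
    intro X
    rw [funext_iff]
    exact ⟨fun hX k hk => hX ⟨k, Finset.mem_Iic.2 hk⟩,
      fun hX k => hX k (Finset.mem_Iic.1 k.2)⟩
  have e1 : Preorder.frestrictLe (π := fun _ => ℤ) n ⁻¹' {fun k : Finset.Iic n => h k} =
      {X | ∀ k ≤ n, X k = h k} := by
    ext X
    exact hmem X
  have e2 : (fun X : ℕ → ℤ => (Preorder.frestrictLe (π := fun _ => ℤ) n X, X (n + 1))) ⁻¹'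
      ({fun k : Finset.Iic n => h k} ×ˢ {h (n + 1)}) = {X | ∀ k ≤ n + 1, X k = h k} := by
    ext X
    rw [mem_preimage, mem_prod, mem_singleton_iff, mem_singleton_iff, hmem, mem_ofPred_eq]
    simp only [Nat.le_succ_iff]
    constructor
    · rintro ⟨h2, h3⟩ k (hk | rfl)
      · exact h2 k hk
      · exact h3
    · exact fun h2 => ⟨fun k hk => h2 k (Or.inl hk), h2 _ (Or.inr rfl)⟩
  rw [e1, e2] at h1
  rw [← h1, smul_eq_mul]

theorem trajMeasure_prefix_zero {μ₀ : Measure ℤ} [IsProbabilityMeasure μ₀]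
    (κ : (n : ℕ) → Kernel (Finset.Iic n → ℤ) ℤ) [∀ n, IsMarkovKernel (κ n)] (h : ℕ → ℤ) :
    Kernel.trajMeasure (X := fun _ => ℤ) μ₀ κ {X | ∀ k ≤ 0, X k = h k} = μ₀ {h 0} := by
  have hmap : (Kernel.trajMeasure (X := fun _ => ℤ) μ₀ κ).map (Preorder.frestrictLe 0) =
      μ₀.map (MeasurableEquiv.piUnique fun _ : Finset.Iic 0 => ℤ).symm := by
    rw [Kernel.trajMeasure, Measure.map_comp _ _ (by fun_prop), Kernel.traj_map_frestrictLe,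
      Kernel.partialTraj_self, Measure.id_comp]
  have h1 := congrArg (fun m => m {fun k : Finset.Iic 0 => h k}) hmap
  rw [Measure.map_apply (by fun_prop) (measurableSet_singleton _),
    Measure.map_apply (by fun_prop) (measurableSet_singleton _)] at h1
  convert h1 using 2
  · ext X
    simp only [mem_ofPred_eq, mem_preimage, mem_singleton_iff, funext_iff]
    exact ⟨fun hX k => hX k (Finset.mem_Iic.1 k.2), fun hX k hk => hX ⟨k, Finset.mem_Iic.2 hk⟩⟩
  · ext z
    simp only [mem_preimage, mem_singleton_iff, funext_iff]
    constructor
    · rintro rfl ⟨k, hk⟩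
      obtain rfl : k = 0 := Nat.le_zero.1 (Finset.mem_Iic.1 hk)
      rfl
    · exact fun hz => hz ⟨0, Finset.mem_Iic.2 le_rfl⟩

/-- Both measures are projective limits of the same finite-dimensional laws, which are determined by
singletons because path prefixes are countable. -/
theorem measure_path_ext {μ ν : Measure (ℕ → ℤ)} [IsProbabilityMeasure μ] [IsProbabilityMeasure ν]
    (h : ∀ (n : ℕ) (h : ℕ → ℤ), μ {X | ∀ k ≤ n, X k = h k} = ν {X | ∀ k ≤ n, X k = h k}) :
    μ = ν := by
  have h1 : ∀ n : ℕ, μ.map (Preorder.frestrictLe (π := fun _ => ℤ) n) =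
      ν.map (Preorder.frestrictLe (π := fun _ => ℤ) n) := by
    intro n
    refine Measure.ext_of_singleton fun p => ?_
    rw [Measure.map_apply (by fun_prop) (measurableSet_singleton _),
      Measure.map_apply (by fun_prop) (measurableSet_singleton _)]
    have : Preorder.frestrictLe (π := fun _ => ℤ) n ⁻¹' {p} =
        {X | ∀ k ≤ n, X k = extendPath p k} := by
      ext X
      simp only [mem_preimage, mem_singleton_iff, mem_ofPred_eq, funext_iff]
      constructor
      · intro hk k hkn
        rw [extendPath, dif_pos hkn, ← hk ⟨k, Finset.mem_Iic.2 hkn⟩]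
        rfl
      · rintro hk ⟨k, hkn⟩
        have := hk k (Finset.mem_Iic.1 hkn)
        rwa [extendPath, dif_pos (Finset.mem_Iic.1 hkn)] at this
    rw [this, h]
  have h2 : IsProjectiveLimit μ fun I : Finset ℕ => μ.map I.restrict := fun _ => rfl
  have h3 : IsProjectiveLimit ν fun I : Finset ℕ => μ.map I.restrict := by
    refine (isProjectiveLimit_nat_iff (fun I J hJI => ?_) ν).2 fun n => (h1 n).symm
    rw [Measure.map_map (by fun_prop) (by fun_prop)]
    rfl
  exact h2.unique h3

/-- The probability of a right jump from a site after `i` visits and `c` right jumps. -/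
noncomputable def urnProb (f : ℝ → ℝ) (α l : ℝ) (c i : ℕ) : ℝ := f ((α * l + c) / (l + i))

/-- The reinforced walk is the walk that follows independent stacks of urn draws. -/
theorem map_walk_eq_reinforcedWalkLaw {f : ℝ → ℝ} (hf : ∀ x, f x ∈ Icc (0 : ℝ) 1) (α l : ℝ) :
    (Measure.infinitePi fun _ : ℤ => urnLaw (urnProb f α l)).map walk =
      reinforcedWalkLaw f 0 fun _ => (α, l) := by
  have : IsProbabilityMeasure
      ((Measure.infinitePi fun _ : ℤ => urnLaw (urnProb f α l)).map walk) :=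
    Measure.isProbabilityMeasure_map measurable_walk.aemeasurable
  have hm : ∀ (n : ℕ) (h : ℕ → ℤ), MeasurableSet {X : ℕ → ℤ | ∀ k ≤ n, X k = h k} := by
    intro n h
    have : {X : ℕ → ℤ | ∀ k ≤ n, X k = h k} = ⋂ k, ⋂ _ : k ≤ n, {X | X k = h k} := by
      ext; simp
    rw [this]
    exact MeasurableSet.iInter fun k => MeasurableSet.iInter fun _ =>
      measurableSet_eq_fun (measurable_pi_apply k) measurable_const
  refine measure_path_ext fun n h => ?_
  rw [Measure.map_apply measurable_walk (hm n h)]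
  rw [show walk ⁻¹' {X | ∀ k ≤ n, X k = h k} = {ω | ∀ k ≤ n, walk ω k = h k} from rfl]
  induction n with
  | zero =>
    rw [reinforcedWalkLaw, trajMeasure_prefix_zero, Measure.dirac_apply' _ (by simp)]
    by_cases h0 : h 0 = 0
    · simp [h0, (follows_walk _).1]
    · have : ∀ ω, walk ω 0 ≠ h 0 := fun ω => by rw [(follows_walk ω).1]; exact Ne.symm h0
      simp [this, Ne.symm h0]
  | succ n ih =>
    rw [infinitePi_walk_succ (isUrnLaw_urnLaw (p := urnProb f α l) fun _ _ => hf _), ih, reinforcedWalkLaw,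
      trajMeasure_prefix_succ]
    congr 1
    have hk : stepKernel f (fun _ => (α, l)) n (fun k : Finset.Iic n => h k) =
        bernoulliMeasure (extendPath (fun k : Finset.Iic n => h k) n + 1)
          (extendPath (fun k : Finset.Iic n => h k) n - 1) (projIcc (0 : ℝ) 1 zero_le_one
            (f (redProportion (fun _ => (α, l)) (extendPath fun k : Finset.Iic n => h k) n
              (extendPath (fun k : Finset.Iic n => h k) n)))) := rfl
    have hext : ∀ k ≤ n, extendPath (fun k : Finset.Iic n => h k) k = h k := fun k hk => by
      simp [extendPath, hk]
    rw [hk, hext n le_rfl, redProportion, rightJumps_congr hext, visits_congr fun k hk => hext k hk.le,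
      bernoulliMeasure_def]
    have hproj := projIcc_of_mem zero_le_one
      (hf ((α * l + (rightJumps h n (h n) : ℝ)) / (l + (visits h n (h n) : ℝ))))
    simp only [urnProb] at *
    rw [hproj]
    simp only [Measure.add_apply, Measure.smul_apply, Measure.dirac_apply' _
      (measurableSet_singleton _), indicator, mem_singleton_iff, Pi.one_apply, eq_comm]
    have hofReal : ∀ t : unitInterval,
        ((unitInterval.toNNReal t : NNReal) : ENNReal) = ENNReal.ofReal t :=
      fun t => (ENNReal.ofReal_eq_coe_nnreal t.2.1).symm
    simp only [ENNReal.smul_def, hofReal, smul_eq_mul, unitInterval.coe_symm_eq]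

/-! ### Drift, Wald's identity and a generating function bound. -/

/-- The expected positive drift of the draws that are made up to the `(v + 1)`-th `true`. -/
noncomputable def siteDrift (p : ℕ → ℕ → ℝ) (ν : Measure (ℕ → Bool)) (v : ℕ) : ENNReal :=
  ∑' j, ∫⁻ a, (if heads a j ≤ v then ENNReal.ofReal (2 * p (heads a j) j - 1) else 0) ∂ν

/-- The expected total positive drift of the draws of an urn. -/
noncomputable def totalDrift (p : ℕ → ℕ → ℝ) (ν : Measure (ℕ → Bool)) : ENNReal :=
  ∑' j, ∫⁻ a, ENNReal.ofReal (2 * p (heads a j) j - 1) ∂ν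

theorem measurable_heads_comp {β : Type*} [MeasurableSpace β] (g : ℕ → β) (j : ℕ) :
    Measurable fun a => g (heads a j) :=
  (measurable_of_countable g).comp (measurable_heads j)

theorem measurable_heads_comp₂ {β : Type*} [MeasurableSpace β] (g : ℕ → Bool → β) (j : ℕ) :
    Measurable fun a : ℕ → Bool => g (heads a j) (a j) :=
  (measurable_of_countable fun x : ℕ × Bool => g x.1 x.2).comp
    ((measurable_heads j).prodMk (measurable_pi_apply j))

theorem heads_nth {a : ℕ → Bool} (ha : IsMixed a) (v : ℕ) :
    heads a (Nat.nth (fun i => a i = true) v) = v :=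
  Nat.count_nth_of_infinite ha.1 v

theorem heads_le_iff {a : ℕ → Bool} (ha : IsMixed a) (v j : ℕ) :
    heads a j ≤ v ↔ j ≤ Nat.nth (fun i => a i = true) v :=
  Nat.count_le_iff_le_nth ha.1

theorem apply_nth {a : ℕ → Bool} (ha : IsMixed a) (v : ℕ) :
    a (Nat.nth (fun i => a i = true) v) = true :=
  Nat.nth_mem_of_infinite ha.1 v

theorem sum_ite_heads (a : ℕ → Bool) (n : ℕ) :
    ∑ j ∈ Finset.range n, (if a j = true then 1 else 0 : ENNReal) = heads a n := by
  induction n with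
  | zero => simp [heads_zero]
  | succ n ih =>
    rw [Finset.sum_range_succ, ih, heads_succ]
    push_cast
    rfl

theorem tsum_true {a : ℕ → Bool} (ha : IsMixed a) (v : ℕ) :
    ∑' j, (if heads a j ≤ v then (if a j = true then 1 else 0) else 0 : ENNReal) = v + 1 := by
  rw [tsum_eq_sum (s := Finset.range (Nat.nth (fun i => a i = true) v + 1))]
  · have : heads a (Nat.nth (fun i => a i = true) v + 1) = v + 1 := by
      rw [heads_succ, heads_nth ha, apply_nth ha]
      rfl
    rw [← Nat.cast_add_one, ← this, ← sum_ite_heads]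
    refine Finset.sum_congr rfl fun j hj => ?_
    rw [if_pos ((heads_le_iff ha v j).2 (Nat.lt_succ_iff.1 (Finset.mem_range.1 hj)))]
  · intro j hj
    rw [if_neg]
    rw [heads_le_iff ha]
    simp only [Finset.mem_range] at hj
    omega

theorem tsum_false {a : ℕ → Bool} (ha : IsMixed a) (v : ℕ) :
    ∑' j, (if heads a j ≤ v then (if a j = true then 0 else 1) else 0 : ENNReal) =
      backJumps a v := by
  rw [tsum_eq_sum (s := Finset.range (Nat.nth (fun i => a i = true) v))]
  · have : backJumps a v = heads (fun i => !a i) (Nat.nth (fun i => a i = true) v) := by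
      rw [heads_not, heads_nth ha, backJumps]
    rw [this, ← sum_ite_heads]
    refine Finset.sum_congr rfl fun j hj => ?_
    rw [if_pos ((heads_le_iff ha v j).2 (Finset.mem_range.1 hj).le)]
    cases a j <;> simp
  · intro j hj
    simp only [Finset.mem_range, not_lt] at hj
    rcases hj.eq_or_lt with h | h
    · rw [← h, apply_nth ha]
      simp
    · rw [if_neg]
      rw [heads_le_iff ha]
      omega

/-- Wald's identity for the draws up to the `(v + 1)`-th `true`. -/
theorem lintegral_backJumps_add_siteDrift {p : ℕ → ℕ → ℝ} {ν : Measure (ℕ → Bool)}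
    [IsProbabilityMeasure ν] (hν : IsUrnLaw p ν) (hmix : ∀ᵐ a ∂ν, IsMixed a)
    (hp : ∀ c i, 1 / 2 ≤ p c i) (hp1 : ∀ c i, p c i ≤ 1) (v : ℕ) :
    ∫⁻ a, (backJumps a v : ENNReal) ∂ν + siteDrift p ν v = v + 1 := by
  -- Whether draw `j` is counted is decided by `heads a j`, hence by earlier draws, so its indicator
  -- may be replaced by its conditional probability.
  have h1 : ∫⁻ a, (backJumps a v : ENNReal) ∂ν =
      ∑' j, ∫⁻ a, (if heads a j ≤ v then ENNReal.ofReal (1 - p (heads a j) j) else 0) ∂ν := by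
    rw [lintegral_congr_ae (hmix.mono fun a ha => (tsum_false ha v).symm), lintegral_tsum]
    · refine tsum_congr fun j => ?_
      rw [hν.lintegral j fun c x => if c ≤ v then (if x = true then 0 else 1) else 0]
      refine lintegral_congr fun a => ?_
      split_ifs <;> simp_all
    · exact fun j => (measurable_heads_comp₂
        (fun c x => if c ≤ v then (if x = true then 0 else 1 : ENNReal) else 0) j).aemeasurable
  have h2 : ((v : ENNReal) + 1) =
      ∑' j, ∫⁻ a, (if heads a j ≤ v then ENNReal.ofReal (p (heads a j) j) else 0) ∂ν := by
    have : ((v : ENNReal) + 1) = ∫⁻ _, ((v : ENNReal) + 1) ∂ν := by simp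
    rw [this, lintegral_congr_ae (hmix.mono fun a ha => (tsum_true ha v).symm), lintegral_tsum]
    · refine tsum_congr fun j => ?_
      rw [hν.lintegral j fun c x => if c ≤ v then (if x = true then 1 else 0) else 0]
      refine lintegral_congr fun a => ?_
      split_ifs <;> simp_all
    · exact fun j => (measurable_heads_comp₂
        (fun c x => if c ≤ v then (if x = true then 1 else 0 : ENNReal) else 0) j).aemeasurable
  -- The identity now holds term by term, since `(1 - p) + (2p - 1) = p`.
  rw [h1, h2, siteDrift, ← ENNReal.tsum_add]
  refine tsum_congr fun j => ?_
  rw [← lintegral_add_left (measurable_heads_comp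
    (fun c => if c ≤ v then ENNReal.ofReal (1 - p c j) else 0) j)]
  refine lintegral_congr fun a => ?_
  split_ifs
  · have := hp (heads a j) j
    have := hp1 (heads a j) j
    rw [← ENNReal.ofReal_add (by linarith) (by linarith)]
    congr 1
    ring
  · simp

theorem tsum_exit {a : ℕ → Bool} (ha : IsMixed a) (v : ℕ) (g : ℕ → ENNReal) :
    ∑' j, (if heads a j = v then (if a j = true then g (j - v) else 0) else 0) =
      g (backJumps a v) := by
  rw [tsum_eq_single (Nat.nth (fun i => a i = true) v)]
  · rw [if_pos (heads_nth ha v), if_pos (apply_nth ha v), backJumps]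
  · intro j hj
    split_ifs with h1 h2
    · exact absurd (by rw [← h1]; exact (Nat.nth_count h2).symm) hj
    · rfl
    · rfl

/-- Bound for the generating function of the number of `false`s before the `(v + 1)`-th `true`. -/
theorem lintegral_pow_backJumps_le {p : ℕ → ℕ → ℝ} {ν : Measure (ℕ → Bool)}
    [IsProbabilityMeasure ν] (hν : IsUrnLaw p ν) (hmix : ∀ᵐ a ∂ν, IsMixed a)
    (hp : ∀ c i, p c i ∈ Icc (0 : ℝ) 1) {ε : ℝ} (h0 : 0 < ε) (h1 : ε < 1) (v : ℕ) :
    ∫⁻ a, ENNReal.ofReal ((1 - ε) ^ backJumps a v) ∂ν ≤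
      ENNReal.ofReal ((1 + ε) ^ (v + 1))⁻¹ + ENNReal.ofReal ε * siteDrift p ν v := by
  -- The weight gains a factor `1 + ε` per `true` and `1 - ε` per `false`; its conditional mean is
  -- multiplied by `1 + ε (2p - 1)`, so it grows at most through the positive drift.
  set N : ℕ → ℕ → ℝ := fun j c => (1 - ε) ^ (j - c) * (1 + ε) ^ c with hN
  have hN0 : ∀ j c, 0 ≤ N j c := fun j c => by
    have : 0 ≤ 1 - ε := by linarith
    positivity
  have hN1 : ∀ j c, c ≤ v → N j c ≤ (1 + ε) ^ v := fun j c hc => by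
    have e1 : (1 - ε) ^ (j - c) ≤ 1 := pow_le_one₀ (by linarith) (by linarith)
    have e2 : (1 + ε) ^ c ≤ (1 + ε) ^ v := pow_le_pow_right₀ (by linarith) hc
    have e3 : 0 < (1 + ε) ^ c := by positivity
    have e4 : 0 ≤ (1 - ε) ^ (j - c) := pow_nonneg (by linarith) _
    nlinarith
  -- Here `z j` is the mean weight not yet stopped, `e j` the mean weight stopped by the `(v +
  -- 1)`-th `true` at draw `j`, and `b j` a bound for the gain, using that the weight is at most `(1
  -- + ε) ^ v` before stopping.
  set z : ℕ → ENNReal := fun j =>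
    ∫⁻ a, (if heads a j ≤ v then ENNReal.ofReal (N j (heads a j)) else 0) ∂ν with hz
  set e : ℕ → ENNReal := fun j => ∫⁻ a, (if heads a j = v then (if a j = true then
    ENNReal.ofReal ((1 - ε) ^ (j - v) * (1 + ε) ^ (v + 1)) else 0) else 0) ∂ν with he
  set b : ℕ → ENNReal := fun j => ENNReal.ofReal (ε * (1 + ε) ^ v) * ∫⁻ a, (if heads a j ≤ v then
    ENNReal.ofReal (2 * p (heads a j) j - 1) else 0) ∂ν with hb
  have hstep : ∀ j, z (j + 1) + e j ≤ z j + b j := by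
    intro j
    have hl : z (j + 1) + e j = ∫⁻ a, (fun c x => if c ≤ v then
        ENNReal.ofReal (N j c * (if x = true then 1 + ε else 1 - ε)) else 0)
          (heads a j) (a j) ∂ν := by
      simp only [hz, he]
      rw [← lintegral_add_left
        (measurable_heads_comp (fun c => if c ≤ v then ENNReal.ofReal (N (j + 1) c) else 0) _)]
      refine lintegral_congr fun a => ?_
      have hle := heads_le a j
      rw [heads_succ]
      cases hx : a j
      · have : j + 1 - heads a j = (j - heads a j) + 1 := by omega
        simp only [Bool.false_eq_true, if_false, add_zero, ite_self, hN, this, pow_succ]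
        split_ifs
        · congr 1; ring
        · rfl
      · simp only [if_true, hN, Nat.add_sub_add_right]
        by_cases h2 : heads a j + 1 ≤ v
        · rw [if_pos h2, if_neg (by omega), if_pos (by omega), add_zero, pow_succ, mul_assoc]
        · by_cases h3 : heads a j = v
          · rw [if_neg h2, if_pos h3, if_pos h3.le, zero_add, h3, pow_succ, mul_assoc]
          · rw [if_neg h2, if_neg h3, if_neg (by omega), zero_add]
    rw [hl, hν.lintegral j fun c x => if c ≤ v then
      ENNReal.ofReal (N j c * (if x = true then 1 + ε else 1 - ε)) else 0]
    simp only [hz, hb]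
    rw [← lintegral_const_mul _ (measurable_heads_comp
      (fun c => if c ≤ v then ENNReal.ofReal (2 * p c j - 1) else 0) j), ← lintegral_add_left
        (measurable_heads_comp (fun c => if c ≤ v then ENNReal.ofReal (N j c) else 0) _)]
    refine lintegral_mono fun a => ?_
    have hpa := hp (heads a j) j
    have hNa := hN0 j (heads a j)
    by_cases hv : heads a j ≤ v
    · simp only [if_pos hv, if_true, Bool.false_eq_true, if_false]
      rw [← ENNReal.ofReal_mul hpa.1, ← ENNReal.ofReal_mul (by linarith [hpa.2]),
        ← ENNReal.ofReal_add (mul_nonneg hpa.1 (mul_nonneg hNa (by linarith)))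
          (mul_nonneg (by linarith [hpa.2]) (mul_nonneg hNa (by linarith))),
        ← ENNReal.ofReal_mul (by positivity)]
      have hNv := hN1 j _ hv
      rcases le_total (2 * p (heads a j) j - 1) 0 with h2 | h2
      · refine le_trans (ENNReal.ofReal_le_ofReal ?_) le_self_add
        have := mul_nonneg hNa h0.le
        nlinarith
      · rw [← ENNReal.ofReal_add hNa (by positivity)]
        refine ENNReal.ofReal_le_ofReal ?_
        have : 0 ≤ ε * (2 * p (heads a j) j - 1) := mul_nonneg h0.le h2
        nlinarith
    · simp [if_neg hv]
  have hsum : ∀ m, ∑ j ∈ Finset.range m, e j + z m ≤ 1 + ∑ j ∈ Finset.range m, b j := by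
    intro m
    induction m with
    | zero => simp [hz, hN, heads_zero]
    | succ m ih =>
      rw [Finset.sum_range_succ, Finset.sum_range_succ]
      calc ∑ j ∈ Finset.range m, e j + e m + z (m + 1)
          = ∑ j ∈ Finset.range m, e j + (z (m + 1) + e m) := by ring
        _ ≤ ∑ j ∈ Finset.range m, e j + (z m + b m) := 
          add_le_add le_rfl (hstep m)
        _ = (∑ j ∈ Finset.range m, e j + z m) + b m := by ring
        _ ≤ (1 + ∑ j ∈ Finset.range m, b j) + b m := by gcongr
        _ = _ := by ring
  have htot : ∑' j, e j ≤ 1 + ENNReal.ofReal (ε * (1 + ε) ^ v) * siteDrift p ν v := by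
    rw [ENNReal.tsum_eq_iSup_nat, siteDrift, ← ENNReal.tsum_mul_left]
    refine iSup_le fun m => (le_self_add.trans (hsum m)).trans ?_
    gcongr
    exact ENNReal.sum_le_tsum _
  have hexit : ∑' j, e j =
      ENNReal.ofReal ((1 + ε) ^ (v + 1)) * ∫⁻ a, ENNReal.ofReal ((1 - ε) ^ backJumps a v) ∂ν := by
    rw [← lintegral_tsum, ← lintegral_const_mul']
    · refine lintegral_congr_ae (hmix.mono fun a ha => ?_)
      beta_reduce
      rw [tsum_exit ha v fun k => ENNReal.ofReal ((1 - ε) ^ k * (1 + ε) ^ (v + 1)), mul_comm,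
        ENNReal.ofReal_mul (pow_nonneg (by linarith) _), mul_comm]
    · exact ENNReal.ofReal_ne_top
    · exact fun j => (measurable_heads_comp₂ (fun c x => if c = v then (if x = true then
        ENNReal.ofReal ((1 - ε) ^ (j - v) * (1 + ε) ^ (v + 1)) else 0) else 0) j).aemeasurable
  rw [hexit] at htot
  have hc : 0 < (1 + ε) ^ (v + 1) := by positivity
  calc ∫⁻ a, ENNReal.ofReal ((1 - ε) ^ backJumps a v) ∂ν
      = ENNReal.ofReal ((1 + ε) ^ (v + 1))⁻¹ * (ENNReal.ofReal ((1 + ε) ^ (v + 1)) *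
          ∫⁻ a, ENNReal.ofReal ((1 - ε) ^ backJumps a v) ∂ν) := by
        rw [← mul_assoc, ← ENNReal.ofReal_mul (by positivity), inv_mul_cancel₀ hc.ne',
          ENNReal.ofReal_one, one_mul]
    _ ≤ ENNReal.ofReal ((1 + ε) ^ (v + 1))⁻¹ *
          (1 + ENNReal.ofReal (ε * (1 + ε) ^ v) * siteDrift p ν v) := by gcongr
    _ = ENNReal.ofReal ((1 + ε) ^ (v + 1))⁻¹ +
          ENNReal.ofReal (((1 + ε) ^ (v + 1))⁻¹ * (ε * (1 + ε) ^ v)) * siteDrift p ν v := by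
        rw [mul_add, mul_one, ← mul_assoc, ← ENNReal.ofReal_mul (by positivity)]
    _ ≤ _ := by
        gcongr
        rw [inv_mul_le_iff₀ hc, pow_succ]
        have : 0 < (1 + ε) ^ v := by positivity
        nlinarith [mul_pos h0 this, mul_pos h0 (mul_pos h0 this)]

theorem siteDrift_mono (p : ℕ → ℕ → ℝ) (ν : Measure (ℕ → Bool)) : Monotone (siteDrift p ν) := by
  intro v w h
  refine ENNReal.tsum_le_tsum fun j => lintegral_mono fun a => ?_
  by_cases hv : heads a j ≤ v
  · simp only [if_pos hv, if_pos (hv.trans h), le_refl]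
  · simp only [if_neg hv, zero_le]

theorem exists_lt_siteDrift {p : ℕ → ℕ → ℝ} {ν : Measure (ℕ → Bool)} {c : ENNReal}
    (h : c < totalDrift p ν) : ∃ v, c < siteDrift p ν v := by
  rw [totalDrift, ENNReal.tsum_eq_iSup_nat, lt_iSup_iff] at h
  obtain ⟨m, hm⟩ := h
  refine ⟨m, hm.trans_le ?_⟩
  refine le_trans (Finset.sum_le_sum fun j hj => lintegral_mono fun a => ?_)
    (ENNReal.sum_le_tsum (Finset.range m))
  rw [if_pos ((heads_le a j).trans (Finset.mem_range.1 hj).le)]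

/-- The draws counted in `siteDrift` have `heads a i ≤ v`, so drift collected beyond `v` at a single
time `j` is an additional part of the total. -/
theorem siteDrift_add_le (p : ℕ → ℕ → ℝ) (ν : Measure (ℕ → Bool)) (v j : ℕ) :
    siteDrift p ν v +
      ∫⁻ a, (if v < heads a j then ENNReal.ofReal (2 * p (heads a j) j - 1) else 0) ∂ν ≤
      totalDrift p ν := by
  classical
  have h1 : ∫⁻ a, (if v < heads a j then ENNReal.ofReal (2 * p (heads a j) j - 1) else 0) ∂ν ≤
      ∑' i, ∫⁻ a, (if v < heads a i then ENNReal.ofReal (2 * p (heads a i) i - 1) else 0) ∂ν :=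
    ENNReal.le_tsum (f := fun i =>
      ∫⁻ a, (if v < heads a i then ENNReal.ofReal (2 * p (heads a i) i - 1) else 0) ∂ν) j
  refine (add_le_add_right h1 _).trans ?_
  rw [siteDrift, totalDrift, ← ENNReal.tsum_add]
  refine ENNReal.tsum_le_tsum fun i => ?_
  rw [← lintegral_add_left (measurable_heads_comp
    (fun c => if c ≤ v then ENNReal.ofReal (2 * p c i - 1) else 0) i)]
  refine lintegral_mono fun a => ?_
  by_cases hv : heads a i ≤ v
  · simp [hv, not_lt.2 hv]
  · simp [hv, not_le.1 hv]

/-! ### Shift invariance, measurability and monotonicity of the branching process. -/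

theorem measurePreserving_head_tail {α : Type*} [MeasurableSpace α] (ν : Measure α)
    [IsProbabilityMeasure ν] :
    MeasurePreserving (fun ω : ℕ → α => (ω 0, fun x => ω (x + 1)))
      (Measure.infinitePi fun _ : ℕ => ν) (ν.prod (Measure.infinitePi fun _ : ℕ => ν)) := by
  classical
  set cons : α × (ℕ → α) → ℕ → α := fun z n => Nat.casesOn n z.1 z.2 with hcons
  have hm : Measurable cons := by
    refine measurable_pi_lambda _ fun n => ?_
    cases n with
    | zero => exact measurable_fst
    | succ n => exact (measurable_pi_apply n).comp measurable_snd
  have hm' : Measurable fun ω : ℕ → α => (ω 0, fun x => ω (x + 1)) := by fun_prop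
  have hmap : (ν.prod (Measure.infinitePi fun _ : ℕ => ν)).map cons =
      Measure.infinitePi fun _ : ℕ => ν := by
    refine Measure.eq_infinitePi _ fun s t ht => ?_
    obtain ⟨N, hN⟩ : ∃ N, s ⊆ Finset.range (N + 1) :=
      ⟨s.sup id, fun k hk => Finset.mem_range.2 (Nat.lt_succ_of_le (Finset.le_sup (f := id) hk))⟩
    set t' : ℕ → Set α := fun i => if i ∈ s then t i else univ with ht'
    have hmt' : ∀ i, MeasurableSet (t' i) := fun i => by
      by_cases hi : i ∈ s
      · simpa only [ht', if_pos hi] using ht i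
      · simp only [ht', if_neg hi, MeasurableSet.univ]
    have h1 : ∏ i ∈ s, ν (t i) = ∏ i ∈ Finset.range (N + 1), ν (t' i) := by
      rw [← Finset.prod_subset hN]
      · exact Finset.prod_congr rfl fun i hi => by simp only [ht', if_pos hi]
      · intro i _ hi
        simp only [ht', if_neg hi, measure_univ]
    have h2 : cons ⁻¹' (Set.pi (s : Set ℕ) t) =
        t' 0 ×ˢ Set.pi (Finset.range N : Set ℕ) fun i => t' (i + 1) := by
      ext z
      simp only [mem_preimage, Set.mem_pi, Finset.mem_coe, mem_prod, ht']
      constructor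
      · intro h
        refine ⟨?_, fun i _ => ?_⟩
        · split_ifs with h0
          · exact h 0 h0
          · trivial
        · split_ifs with hi
          · exact h (i + 1) hi
          · trivial
      · rintro ⟨h0, h3⟩ i hi
        cases i with
        | zero =>
          rw [if_pos hi] at h0
          exact h0
        | succ i =>
          have := Finset.mem_range.1 (hN hi)
          simpa [hi] using h3 i (Finset.mem_range.2 (by omega))
    rw [Measure.map_apply hm (MeasurableSet.pi s.countable_toSet fun i _ => ht i), h2,
      Measure.prod_prod, Measure.infinitePi_pi _ fun i _ => hmt' _, h1, Finset.prod_range_succ',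
      mul_comm]
  refine ⟨hm', ?_⟩
  rw [← hmap, Measure.map_map hm' hm, hmap]
  exact Measure.map_id

theorem lintegral_head_tail {α : Type*} [MeasurableSpace α] (ν : Measure α)
    [IsProbabilityMeasure ν] {g : α → (ℕ → α) → ENNReal} (hg : Measurable (Function.uncurry g)) :
    ∫⁻ ω, g (ω 0) (fun x => ω (x + 1)) ∂(Measure.infinitePi fun _ : ℕ => ν) =
      ∫⁻ ω, ∫⁻ a, g a ω ∂ν ∂(Measure.infinitePi fun _ : ℕ => ν) := by
  exact ((measurePreserving_head_tail ν).lintegral_comp hg).trans (lintegral_prod_symm' _ hg)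

theorem measurable_backJumps (v : ℕ) : Measurable fun a => backJumps a v := by
  have h : Measurable fun a : ℕ → Bool => Nat.nth (fun i => a i = true) v := by
    refine measurable_to_countable' fun m => ?_
    -- The second alternative accounts for the default value `0` of `Nat.nth` when there are too few
    -- `true`s.
    have hiff : ∀ a : ℕ → Bool, Nat.nth (fun i => a i = true) v = m ↔
        (a m = true ∧ heads a m = v) ∨ (m = 0 ∧ ∀ k, ¬(a k = true ∧ heads a k = v)) := by
      intro a
      by_cases hex : ∃ k, a k = true ∧ heads a k = v
      · obtain ⟨k, hk, rfl⟩ := hex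
        have : Nat.nth (fun i => a i = true) (heads a k) = k := Nat.nth_count hk
        rw [this]
        constructor
        · rintro rfl
          exact Or.inl ⟨hk, rfl⟩
        · rintro (⟨h1, h2⟩ | ⟨_, h2⟩)
          · exact (Nat.count_injective h1 hk h2).symm
          · exact absurd ⟨hk, rfl⟩ (h2 k)
      · have h0 : Nat.nth (fun i => a i = true) v = 0 := by
          by_contra hne
          refine hex ⟨_, Nat.nth_mem_of_ne_zero hne, ?_⟩
          exact Nat.count_nth fun hf => Nat.lt_card_toFinset_of_nth_ne_zero hne hf
        rw [h0]
        constructor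
        · rintro rfl
          exact Or.inr ⟨rfl, fun k hk => hex ⟨k, hk⟩⟩
        · rintro (h1 | ⟨h1, _⟩)
          · exact absurd ⟨m, h1⟩ hex
          · exact h1.symm
    have hset : (fun a : ℕ → Bool => Nat.nth (fun i => a i = true) v) ⁻¹' {m} =
        {a | (a m = true ∧ heads a m = v) ∨ (m = 0 ∧ ∀ k, ¬(a k = true ∧ heads a k = v))} := by
      ext a
      exact hiff a
    have hk : ∀ k, MeasurableSet {a : ℕ → Bool | a k = true ∧ heads a k = v} := fun k =>
      (measurableSet_apply_eq k true).inter
        (measurableSet_eq_fun (measurable_heads k) measurable_const)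
    have hall : {a : ℕ → Bool | ∀ k, ¬(a k = true ∧ heads a k = v)} =
        ⋂ k, {a : ℕ → Bool | a k = true ∧ heads a k = v}ᶜ := by
      ext; simp
    have hall' : MeasurableSet {a : ℕ → Bool | ∀ k, ¬(a k = true ∧ heads a k = v)} := by
      rw [hall]
      exact MeasurableSet.iInter fun k => (hk k).compl
    rw [hset]
    exact (hk m).union ((MeasurableSet.const (m = 0)).inter hall')
  exact (measurable_of_countable fun m : ℕ => m - v).comp h

theorem measurable_backJumps_uncurry : Measurable fun z : (ℕ → Bool) × ℕ => backJumps z.1 z.2 :=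
  measurable_from_prod_countable_left measurable_backJumps

theorem measurable_chain (n : ℕ) : Measurable fun ω => chain ω n := by
  induction n with
  | zero => exact measurable_const
  | succ n ih =>
    have h1 : Measurable fun (ω : ℕ → ℕ → Bool) (x : ℕ) => ω (x + 1) := by fun_prop
    exact measurable_backJumps_uncurry.comp ((measurable_pi_apply 0).prodMk (ih.comp h1))

theorem backJumps_mono {a : ℕ → Bool} (ha : IsMixed a) : Monotone (backJumps a) := by
  refine monotone_nat_of_le_succ fun v => ?_
  have h1 : Nat.nth (fun i => a i = true) v < Nat.nth (fun i => a i = true) (v + 1) :=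
    Nat.nth_strictMono ha.1 (Nat.lt_succ_self v)
  unfold backJumps
  omega

theorem exists_lt_backJumps {a : ℕ → Bool} (ha : IsMixed a) (M : ℕ) :
    ∃ v, M < backJumps a v := by
  set j := Nat.nth (fun i => (!a i) = true) (M + 1) with hj
  have h1 : heads (fun i => !a i) j = M + 1 := heads_nth ha.not (M + 1)
  refine ⟨heads a j, ?_⟩
  have h2 := (heads_le_iff ha (heads a j) j).1 le_rfl
  rw [heads_not] at h1
  unfold backJumps
  omega

theorem chain_mono {ω : ℕ → ℕ → Bool} (hω : ∀ x, IsMixed (ω x)) : Monotone (chain ω) := by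
  refine monotone_nat_of_le_succ fun n => ?_
  induction n generalizing ω with
  | zero => exact Nat.zero_le _
  | succ n ih => exact backJumps_mono (hω 0) (ih fun x => hω (x + 1))

/-- The stacks for which the branching process of backward jumps stays bounded. -/
def boundedStacks : Set (ℕ → ℕ → Bool) := {ω | ∃ M, ∀ n, chain ω n ≤ M}

theorem measurableSet_boundedStacks : MeasurableSet boundedStacks := by
  have : boundedStacks = ⋃ M, ⋂ n, {ω | chain ω n ≤ M} := by
    ext; simp [boundedStacks]
  rw [this]
  exact MeasurableSet.iUnion fun M => MeasurableSet.iInter fun n =>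
    measurableSet_le (measurable_chain n) measurable_const

/-- `backJumps (ω 0)` is monotone and unbounded, so it carries bounded sequences to bounded ones and
unbounded to unbounded. This invariance allows the one-step recursion to be integrated over
`boundedStacks` or its complement alone. -/
theorem mem_boundedStacks_iff_tail {ω : ℕ → ℕ → Bool} (hω : ∀ x, IsMixed (ω x)) :
    ω ∈ boundedStacks ↔ (fun x => ω (x + 1)) ∈ boundedStacks := by
  constructor
  · rintro ⟨M, hM⟩
    obtain ⟨v, hv⟩ := exists_lt_backJumps (hω 0) M
    refine ⟨v, fun n => ?_⟩
    by_contra hc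
    have h1 := hM (n + 1)
    have h2 := backJumps_mono (hω 0) (not_le.1 hc).le
    rw [chain] at h1
    omega
  · rintro ⟨M, hM⟩
    refine ⟨backJumps (ω 0) M, fun n => ?_⟩
    cases n with
    | zero => exact Nat.zero_le _
    | succ n => exact backJumps_mono (hω 0) (hM n)

/-! ### Boundedness criterion for the branching process. -/

section Chain

variable {p : ℕ → ℕ → ℝ} {ν : Measure (ℕ → Bool)} [IsProbabilityMeasure ν]

theorem ae_forall_isMixed {ι : Type*} [Countable ι] (hmix : ∀ᵐ a ∂ν, IsMixed a) :
    ∀ᵐ ω ∂(Measure.infinitePi fun _ : ι => ν), ∀ x, IsMixed (ω x) := by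
  rw [ae_all_iff]
  intro x
  exact (measurePreserving_eval_infinitePi (fun _ : ι => ν) x).quasiMeasurePreserving.ae hmix

/-- One step of the branching process on a set of stacks that is invariant under the shift. -/
theorem lintegral_chain_succ (hmix : ∀ᵐ a ∂ν, IsMixed a) {A : Set (ℕ → ℕ → Bool)}
    (hA : MeasurableSet A) (hinv : ∀ ω : ℕ → ℕ → Bool, (∀ x, IsMixed (ω x)) →
      (ω ∈ A ↔ (fun x => ω (x + 1)) ∈ A)) (g : ℕ → ENNReal) (n : ℕ) :
    ∫⁻ ω in A, g (chain ω (n + 1)) ∂(Measure.infinitePi fun _ : ℕ => ν) =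
      ∫⁻ ω in A, ∫⁻ a, g (backJumps a (chain ω n)) ∂ν ∂(Measure.infinitePi fun _ : ℕ => ν) := by
  have hg : Measurable g := measurable_of_countable g
  have hm : Measurable (Function.uncurry fun (a : ℕ → Bool) (ω : ℕ → ℕ → Bool) =>
      A.indicator (fun ω => g (backJumps a (chain ω n))) ω) := by
    have h1 : Measurable fun z : (ℕ → Bool) × (ℕ → ℕ → Bool) =>
        g (backJumps z.1 (chain z.2 n)) :=
      hg.comp (measurable_backJumps_uncurry.comp
        (measurable_fst.prodMk ((measurable_chain n).comp measurable_snd)))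
    convert h1.indicator (measurable_snd hA) using 1
    ext z
    by_cases h : z.2 ∈ A
    · rw [indicator_of_mem (show z ∈ Prod.snd ⁻¹' A from h)]
      simp only [Function.uncurry, indicator_of_mem h]
    · rw [indicator_of_notMem (show z ∉ Prod.snd ⁻¹' A from h)]
      simp only [Function.uncurry, indicator_of_notMem h]
  rw [← lintegral_indicator hA, ← lintegral_indicator hA]
  have e1 : ∫⁻ ω, A.indicator (fun ω => g (chain ω (n + 1))) ω
      ∂(Measure.infinitePi fun _ : ℕ => ν) = ∫⁻ ω, (fun (a : ℕ → Bool) (ω : ℕ → ℕ → Bool) =>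
        A.indicator (fun ω => g (backJumps a (chain ω n))) ω) (ω 0) (fun x => ω (x + 1))
          ∂(Measure.infinitePi fun _ : ℕ => ν) := by
    refine lintegral_congr_ae ((ae_forall_isMixed hmix).mono fun ω hω => ?_)
    by_cases h : ω ∈ A
    · simp only [indicator_of_mem h, indicator_of_mem ((hinv ω hω).1 h), chain]
    · simp only [indicator_of_notMem h, indicator_of_notMem (mt (hinv ω hω).2 h)]
  rw [e1, lintegral_head_tail ν hm]
  refine lintegral_congr fun ω => ?_
  by_cases h : ω ∈ A
  · simp only [indicator_of_mem h]
  · simp only [indicator_of_notMem h, lintegral_zero]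

theorem chain_eventually_eq_iSup {ω : ℕ → ℕ → Bool} (hω : ∀ x, IsMixed (ω x))
    (hb : ω ∈ boundedStacks) : ∀ᶠ n in atTop, chain ω n = ⨆ m, chain ω m := by
  obtain ⟨M, hM⟩ := hb
  have hbdd : BddAbove (range (chain ω)) := ⟨M, by rintro _ ⟨n, rfl⟩; exact hM n⟩
  obtain ⟨n, hn⟩ := Nat.sSup_mem (range_nonempty (chain ω)) hbdd
  filter_upwards [eventually_ge_atTop n] with m hm
  exact le_antisymm (le_ciSup hbdd m) (hn.symm.le.trans (chain_mono hω hm))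

theorem measurable_iSup_chain : Measurable fun ω => ⨆ m, chain ω m :=
  Measurable.iSup measurable_chain

theorem tendsto_setIntegral_chain (hmix : ∀ᵐ a ∂ν, IsMixed a) {g : ℕ → ENNReal} {C : ENNReal}
    (hC : C ≠ ⊤) (hg : ∀ v, g v ≤ C) :
    Tendsto (fun n => ∫⁻ ω in boundedStacks, g (chain ω n) ∂(Measure.infinitePi fun _ : ℕ => ν))
      atTop (𝓝 (∫⁻ ω in boundedStacks, g (⨆ m, chain ω m)
        ∂(Measure.infinitePi fun _ : ℕ => ν))) := by
  refine tendsto_lintegral_of_dominated_convergence (fun _ => C)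
    (fun n => (measurable_of_countable g).comp (measurable_chain n))
    (fun n => Eventually.of_forall fun ω => hg _) ?_ ?_
  · rw [lintegral_const]
    exact ENNReal.mul_ne_top hC (measure_ne_top _ _)
  · filter_upwards [ae_restrict_of_ae (ae_forall_isMixed hmix),
      ae_restrict_mem measurableSet_boundedStacks] with ω h1 h2
    refine tendsto_const_nhds.congr' ?_
    filter_upwards [chain_eventually_eq_iSup h1 h2] with n hn
    rw [hn]

/-- Uniform in `v`, this is the domination needed as `ε → 0`. The upper bound applies Bernoulli's
inequality to `(1 + ε) ^ v` and `(1 - ε ^ 2) ^ v`; the terms in `v` cancel. -/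
theorem abs_inv_pow_sub_pow_le {ε : ℝ} (h0 : 0 < ε) (h1 : ε < 1) (v : ℕ) :
    |((1 + ε) ^ (v + 1))⁻¹ - (1 - ε) ^ v| ≤ ε := by
  have hq : 0 < (1 + ε) ^ v := by positivity
  have hr : 0 ≤ (1 - ε) ^ v := pow_nonneg (by linarith) _
  have hr1 : (1 - ε) ^ v ≤ 1 := pow_le_one₀ (by linarith) (by linarith)
  have hprod : (1 - ε) ^ v * (1 + ε) ^ v = (1 - ε ^ 2) ^ v := by rw [← mul_pow]; ring_nf
  rw [abs_le]
  constructor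
  · have h2 : (1 - ε) ^ (v + 1) ≤ ((1 + ε) ^ (v + 1))⁻¹ := by
      rw [le_inv_comm₀ (pow_pos (by linarith) _) (by positivity), ← inv_pow]
      refine pow_le_pow_left₀ (by linarith) ?_ _
      rw [le_inv_comm₀ (by linarith) (by linarith), inv_eq_one_div, le_div_iff₀ (by linarith)]
      nlinarith
    rw [pow_succ] at h2
    nlinarith
  · have h2 : ((1 + ε) ^ (v + 1))⁻¹ ≤ ((1 + ε) ^ v)⁻¹ :=
      inv_anti₀ hq (pow_le_pow_right₀ (by linarith) (Nat.le_succ v))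
    have h3 : 1 + (v : ℝ) * (-ε ^ 2) ≤ (1 + (-ε ^ 2)) ^ v :=
      one_add_mul_le_pow (by nlinarith) v
    have h4 : 1 + (v : ℝ) * ε ≤ (1 + ε) ^ v := one_add_mul_le_pow (by linarith) v
    have h5 : ((1 + ε) ^ v)⁻¹ ≤ ε + (1 - ε) ^ v := by
      rw [inv_eq_one_div, div_le_iff₀ hq, add_mul, hprod]
      have : (1 + (-ε ^ 2)) ^ v = (1 - ε ^ 2) ^ v := by ring_nf
      nlinarith
    linarith

theorem tendsto_inv_pow_sub_pow_div (v : ℕ) :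
    Tendsto (fun k : ℕ => (((1 + 1 / ((k : ℝ) + 2)) ^ (v + 1))⁻¹ - (1 - 1 / ((k : ℝ) + 2)) ^ v) /
      (1 / ((k : ℝ) + 2))) atTop (𝓝 (-1)) := by
  have hd : HasDerivAt (fun x : ℝ => ((1 + x) ^ (v + 1))⁻¹ - (1 - x) ^ v) (-1) 0 := by
    have h1 : HasDerivAt (fun x : ℝ => (1 + x) ^ (v + 1)) (((v + 1 : ℕ) : ℝ)) 0 := by
      simpa using ((hasDerivAt_id (0 : ℝ)).const_add 1).fun_pow (v + 1)
    have h2 : HasDerivAt (fun x : ℝ => (1 - x) ^ v) (-(v : ℝ)) 0 := by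
      simpa using ((hasDerivAt_id (0 : ℝ)).const_sub 1).fun_pow v
    refine ((h1.fun_inv (by simp)).fun_sub h2).congr_deriv ?_
    simp
  have hs := hasDerivAt_iff_tendsto_slope_zero.1 hd
  have ht : Tendsto (fun k : ℕ => 1 / ((k : ℝ) + 2)) atTop (𝓝[≠] 0) := by
    rw [tendsto_nhdsWithin_iff]
    refine ⟨?_, Eventually.of_forall fun k => ?_⟩
    · exact tendsto_const_nhds.div_atTop
        (tendsto_atTop_add_const_right _ _ tendsto_natCast_atTop_atTop)
    · simp only [mem_compl_iff, mem_singleton_iff]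
      positivity
  refine (hs.comp ht).congr fun k => ?_
  simp [div_eq_inv_mul]

/-- The branching process of backward jumps is almost surely unbounded when the positive drift
consumed at a site never reaches one. -/
theorem ae_notMem_boundedStacks (hν : IsUrnLaw p ν) (hmix : ∀ᵐ a ∂ν, IsMixed a)
    (hp : ∀ c i, p c i ∈ Icc (0 : ℝ) 1) (hd : ∀ v, siteDrift p ν v < 1) :
    ∀ᵐ ω ∂(Measure.infinitePi fun _ : ℕ => ν), ω ∉ boundedStacks := by
  set μ := Measure.infinitePi fun _ : ℕ => ν
  set L : (ℕ → ℕ → Bool) → ℕ := fun ω => ⨆ m, chain ω m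
  set d : ℕ → ℝ := fun v => (siteDrift p ν v).toReal
  have hd1 : ∀ v, d v < 1 := fun v => by
    have := (ENNReal.toReal_lt_toReal (hd v).ne_top ENNReal.one_ne_top).2 (hd v)
    simpa using this
  have hd0 : ∀ v, 0 ≤ d v := fun v => ENNReal.toReal_nonneg
  have hdE : ∀ v, siteDrift p ν v = ENNReal.ofReal (d v) := fun v =>
    (ENNReal.ofReal_toReal (hd v).ne_top).symm
  have hint : ∀ (g : ℕ → ℝ) (C : ℝ), (∀ v, |g v| ≤ C) →
      Integrable (fun ω => g (L ω)) (μ.restrict boundedStacks) := fun g C hC =>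
    Integrable.of_bound
      ((measurable_of_countable g).comp measurable_iSup_chain).aestronglyMeasurable C
      (Eventually.of_forall fun ω => hC _)
  -- On `boundedStacks` the chain converges to `L`, whose law there is preserved by one branching
  -- step. As `L` may have infinite mean, stationarity is tested on the bounded function `(1 - ε) ^
  -- v` instead of `v`.
  have hkey : ∀ ε : ℝ, 0 < ε → ε < 1 → 0 ≤ ∫ ω in boundedStacks,
      ((((1 + ε) ^ (L ω + 1))⁻¹ - (1 - ε) ^ L ω) / ε + d (L ω)) ∂μ := by
    intro ε h0 h1
    set s : ℕ → ℝ := fun v => (1 - ε) ^ v with hs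
    set r : ℕ → ℝ := fun v => ((1 + ε) ^ (v + 1))⁻¹ + ε * d v with hr
    have hs0 : ∀ v, 0 ≤ s v := fun v => pow_nonneg (by linarith) _
    have hs1 : ∀ v, s v ≤ 1 := fun v => pow_le_one₀ (by linarith) (by linarith)
    have hr0 : ∀ v, 0 ≤ r v := fun v => by
      have := hd0 v
      positivity
    have hr2 : ∀ v, r v ≤ 2 := fun v => by
      have e1 : ((1 + ε) ^ (v + 1))⁻¹ ≤ 1 := inv_le_one_of_one_le₀ (one_le_pow₀ (by linarith))
      have e2 : ε * d v ≤ 1 := mul_le_one₀ h1.le (hd0 v) (hd1 v).le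
      simp only [hr]
      linarith
    have hn : ∀ n, ∫⁻ ω in boundedStacks, ENNReal.ofReal (s (chain ω (n + 1))) ∂μ ≤
        ∫⁻ ω in boundedStacks, ENNReal.ofReal (r (chain ω n)) ∂μ := by
      intro n
      rw [lintegral_chain_succ hmix measurableSet_boundedStacks
        (fun ω => mem_boundedStacks_iff_tail) (fun v => ENNReal.ofReal (s v))]
      refine lintegral_mono fun ω => ?_
      refine (lintegral_pow_backJumps_le hν hmix hp h0 h1 _).trans ?_
      rw [hdE, ← ENNReal.ofReal_mul h0.le, ← ENNReal.ofReal_add (by positivity)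
        (mul_nonneg h0.le (hd0 _))]
    have hlim := le_of_tendsto_of_tendsto'
      ((tendsto_setIntegral_chain hmix (g := fun v => ENNReal.ofReal (s v)) ENNReal.one_ne_top
        fun v => by simpa using hs1 v).comp (tendsto_add_atTop_nat 1))
      (tendsto_setIntegral_chain hmix (g := fun v => ENNReal.ofReal (r v))
        (ENNReal.ofReal_ne_top (r := 2)) fun v => ENNReal.ofReal_le_ofReal (hr2 v)) hn
    have his := hint s 1 fun v => by rw [abs_of_nonneg (hs0 v)]; exact hs1 v
    have hir := hint r 2 fun v => by rw [abs_of_nonneg (hr0 v)]; exact hr2 v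
    rw [← ofReal_integral_eq_lintegral_ofReal his (Eventually.of_forall fun ω => hs0 _),
      ← ofReal_integral_eq_lintegral_ofReal hir (Eventually.of_forall fun ω => hr0 _),
      ENNReal.ofReal_le_ofReal_iff (integral_nonneg fun ω => hr0 _)] at hlim
    have heq : ∀ ω, (((1 + ε) ^ (L ω + 1))⁻¹ - (1 - ε) ^ L ω) / ε + d (L ω) =
        ε⁻¹ * (r (L ω) - s (L ω)) := by
      intro ω
      simp only [hr, hs]
      field_simp
      ring
    simp_rw [heq]
    rw [integral_const_mul, integral_sub hir his]
    exact mul_nonneg (by positivity) (by linarith)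
  -- Letting `ε = 1 / (k + 2)` tend to `0` recovers the mean increment: the quotient tends to `-(v +
  -- 1) + v = -1`.
  have htend : Tendsto (fun k : ℕ => ∫ ω in boundedStacks,
      ((((1 + 1 / ((k : ℝ) + 2)) ^ (L ω + 1))⁻¹ - (1 - 1 / ((k : ℝ) + 2)) ^ L ω) /
        (1 / ((k : ℝ) + 2)) + d (L ω)) ∂μ) atTop (𝓝 (∫ ω in boundedStacks, (-1 + d (L ω)) ∂μ)) := by
    refine tendsto_integral_of_dominated_convergence (fun _ => 2) (fun k => ?_)
      (integrable_const _) (fun k => Eventually.of_forall fun ω => ?_)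
      (Eventually.of_forall fun ω => (tendsto_inv_pow_sub_pow_div _).add tendsto_const_nhds)
    · exact ((measurable_of_countable fun v : ℕ =>
        (((1 + 1 / ((k : ℝ) + 2)) ^ (v + 1))⁻¹ - (1 - 1 / ((k : ℝ) + 2)) ^ v) /
          (1 / ((k : ℝ) + 2)) + d v).comp measurable_iSup_chain).aestronglyMeasurable
    · have hk : (0 : ℝ) ≤ k := Nat.cast_nonneg k
      have h0 : 0 < 1 / ((k : ℝ) + 2) := by positivity
      have h1 : 1 / ((k : ℝ) + 2) < 1 := by
        rw [div_lt_one (by positivity)]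
        linarith
      rw [Real.norm_eq_abs]
      refine (abs_add_le _ _).trans ?_
      rw [abs_div, abs_of_pos h0, abs_of_nonneg (hd0 _)]
      have := (div_le_one h0).2 (abs_inv_pow_sub_pow_le h0 h1 (L ω))
      linarith [hd1 (L ω)]
  have hle : 0 ≤ ∫ ω in boundedStacks, (-1 + d (L ω)) ∂μ := by
    refine ge_of_tendsto' htend fun k => hkey _ (by positivity) ?_
    rw [div_lt_one (by positivity)]
    have hk : (0 : ℝ) ≤ k := Nat.cast_nonneg k
    linarith
  have hnn : 0 ≤ᵐ[μ.restrict boundedStacks] fun ω => 1 - d (L ω) :=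
    Eventually.of_forall fun ω => by
      have := hd1 (L ω)
      simp only [Pi.zero_apply]
      linarith
  -- The integrand is strictly positive, so a zero integral makes `boundedStacks` null.
  have hz : ∫ ω in boundedStacks, (1 - d (L ω)) ∂μ = 0 := by
    refine le_antisymm ?_ (integral_nonneg_of_ae hnn)
    have : ∫ ω in boundedStacks, (1 - d (L ω)) ∂μ = -∫ ω in boundedStacks, (-1 + d (L ω)) ∂μ := by
      rw [← integral_neg]
      congr 1
      ext ω
      ring
    linarith
  have hae := (integral_eq_zero_iff_of_nonneg_ae hnn (hint (fun v => 1 - d v) 1 fun v => by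
    rw [abs_le]
    constructor <;> linarith [hd0 v, hd1 v])).1 hz
  have := (ae_restrict_iff' measurableSet_boundedStacks).1 hae
  filter_upwards [this] with ω h1 h2
  have h3 := h1 h2
  have h4 := hd1 (L ω)
  simp only [Pi.zero_apply] at h3
  linarith

/-- The branching process of backward jumps is almost surely bounded when the total drift at a
site exceeds one. -/
theorem ae_mem_boundedStacks (hν : IsUrnLaw p ν) (hmix : ∀ᵐ a ∂ν, IsMixed a)
    (hp : ∀ c i, 1 / 2 ≤ p c i) (hp1 : ∀ c i, p c i ≤ 1) (hd : 1 < totalDrift p ν) :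
    ∀ᵐ ω ∂(Measure.infinitePi fun _ : ℕ => ν), ω ∈ boundedStacks := by
  set μ := Measure.infinitePi fun _ : ℕ => ν with hμ
  set A : Set (ℕ → ℕ → Bool) := boundedStacksᶜ with hA
  have hmA : MeasurableSet A := measurableSet_boundedStacks.compl
  by_contra hcon
  have hpos : μ A ≠ 0 := hcon
  have hwald := lintegral_backJumps_add_siteDrift hν hmix hp hp1
  have hfin : ∀ v, siteDrift p ν v ≠ ⊤ := fun v => by
    have : siteDrift p ν v ≤ v + 1 := by rw [← hwald v]; exact le_add_self
    exact ne_top_of_le_ne_top (by simp) this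
  obtain ⟨v₀, hv₀⟩ := exists_lt_siteDrift hd
  set c : ENNReal := siteDrift p ν v₀ with hc
  set a : ℕ → ENNReal := fun n => ∫⁻ ω in A, (chain ω n : ENNReal) ∂μ with ha
  set q : ℕ → ENNReal := fun n => μ (A ∩ {ω | v₀ ≤ chain ω n}) with hq
  -- Wald's identity integrated over the unbounded stacks, keeping only the drift `c > 1` available
  -- once the chain is at least `v₀`.
  have hstep : ∀ n, a (n + 1) + c * q n ≤ a n + μ A := by
    intro n
    have h1 : a (n + 1) = ∫⁻ ω in A, ∫⁻ s, (backJumps s (chain ω n) : ENNReal) ∂ν ∂μ :=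
      lintegral_chain_succ hmix hmA (fun ω hω => not_congr (mem_boundedStacks_iff_tail hω))
        (fun v => (v : ENNReal)) n
    have h2 : c * q n ≤ ∫⁻ ω in A, siteDrift p ν (chain ω n) ∂μ := by
      have hm : MeasurableSet {ω | v₀ ≤ chain ω n} :=
        measurableSet_le measurable_const (measurable_chain n)
      calc c * q n = ∫⁻ ω in A, {ω | v₀ ≤ chain ω n}.indicator (fun _ => c) ω ∂μ := by
            rw [lintegral_indicator_const hm, Measure.restrict_apply hm, inter_comm]
        _ ≤ _ := by
            refine lintegral_mono fun ω => ?_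
            by_cases h : v₀ ≤ chain ω n
            · rw [indicator_of_mem (show ω ∈ {ω | v₀ ≤ chain ω n} from h)]
              exact siteDrift_mono p ν h
            · rw [indicator_of_notMem (show ω ∉ {ω | v₀ ≤ chain ω n} from h)]
              exact zero_le
    have h3 : ∫⁻ ω in A, ∫⁻ s, (backJumps s (chain ω n) : ENNReal) ∂ν ∂μ +
        ∫⁻ ω in A, siteDrift p ν (chain ω n) ∂μ = a n + μ A := by
      have hm : Measurable fun ω => siteDrift p ν (chain ω n) :=
        (measurable_of_countable (siteDrift p ν)).comp (measurable_chain n)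
      have hm2 : Measurable fun ω => (chain ω n : ENNReal) :=
        (measurable_of_countable fun v : ℕ => (v : ENNReal)).comp (measurable_chain n)
      rw [← lintegral_add_right _ hm]
      simp_rw [hwald]
      rw [lintegral_add_left hm2]
      simp [ha]
    rw [h1, ← h3]
    gcongr
  have hafin : ∀ n, a n ≠ ⊤ := by
    intro n
    induction n with
    | zero => simp [ha, chain]
    | succ n ih =>
      exact ne_top_of_le_ne_top (ENNReal.add_ne_top.2 ⟨ih, measure_ne_top _ _⟩)
        (le_self_add.trans (hstep n))
  -- On unbounded stacks the monotone chain eventually exceeds `v₀`.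
  have hqlim : Tendsto q atTop (𝓝 (μ A)) := by
    have h1 : ∀ᵐ ω ∂μ, ω ∈ A → ∀ᶠ n in atTop, v₀ ≤ chain ω n := by
      filter_upwards [ae_forall_isMixed hmix] with ω hω hωA
      have : ¬∀ n, chain ω n ≤ v₀ := fun h => hωA ⟨v₀, h⟩
      push Not at this
      obtain ⟨n, hn⟩ := this
      filter_upwards [eventually_ge_atTop n] with m hm
      exact hn.le.trans (chain_mono hω hm)
    have h2 : ∀ n, q n = ∫⁻ ω in A, {ω | v₀ ≤ chain ω n}.indicator (fun _ => 1) ω ∂μ := by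
      intro n
      have hm : MeasurableSet {ω | v₀ ≤ chain ω n} :=
        measurableSet_le measurable_const (measurable_chain n)
      rw [lintegral_indicator_const hm, Measure.restrict_apply hm, inter_comm, one_mul]
    have h3 : μ A = ∫⁻ ω in A, 1 ∂μ := by simp
    rw [h3]
    refine Tendsto.congr (fun n => (h2 n).symm) ?_
    refine tendsto_lintegral_of_dominated_convergence (fun _ => 1) (fun n => ?_)
      (fun n => Eventually.of_forall fun ω => ?_) (by simp [measure_ne_top]) ?_
    · exact measurable_const.indicator (measurableSet_le measurable_const (measurable_chain n))
    · exact indicator_le_self' (fun _ _ => zero_le) ω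
    · filter_upwards [ae_restrict_of_ae h1, ae_restrict_mem hmA] with ω h4 h5
      refine tendsto_const_nhds.congr' ?_
      filter_upwards [h4 h5] with n hn
      rw [indicator_of_mem (show ω ∈ {ω | v₀ ≤ chain ω n} from hn)]
  have hc1 : 1 < c.toReal := by
    have := (ENNReal.toReal_lt_toReal ENNReal.one_ne_top (hfin v₀)).2 hv₀
    simpa using this
  have hA0 : 0 < (μ A).toReal := ENNReal.toReal_pos hpos (measure_ne_top _ _)
  have hqr : Tendsto (fun n => c.toReal * (q n).toReal) atTop (𝓝 (c.toReal * (μ A).toReal)) :=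
    ((ENNReal.tendsto_toReal (measure_ne_top _ _)).comp hqlim).const_mul _
  have hstepr : ∀ n, (a (n + 1)).toReal + c.toReal * (q n).toReal ≤
      (a n).toReal + (μ A).toReal := by
    intro n
    have := ENNReal.toReal_mono (ENNReal.add_ne_top.2 ⟨hafin n, measure_ne_top _ _⟩) (hstep n)
    rwa [ENNReal.toReal_add (hafin _) (ENNReal.mul_ne_top (hfin _) (measure_ne_top _ _)),
      ENNReal.toReal_add (hafin _) (measure_ne_top _ _), ENNReal.toReal_mul] at this
  set η : ℝ := (c.toReal - 1) * (μ A).toReal / 2 with hη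
  have hη0 : 0 < η := by
    have : 0 < c.toReal - 1 := by linarith
    positivity
  have hev : ∀ᶠ n in atTop, (μ A).toReal + η < c.toReal * (q n).toReal :=
    hqr.eventually_const_lt (by
      have : (c.toReal - 1) * (μ A).toReal = 2 * η := by rw [hη]; ring
      nlinarith)
  obtain ⟨N, hN⟩ := eventually_atTop.1 hev
  -- From time `N` on, the finite mean loses at least `η` per step, so it would become negative.
  have hdec : ∀ k : ℕ, (a (N + k)).toReal ≤ (a N).toReal - k * η := by
    intro k
    induction k with
    | zero => simp
    | succ k ih =>
      have h1 := hstepr (N + k)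
      have h2 := hN (N + k) (by omega)
      rw [← add_assoc]
      push_cast
      linarith
  obtain ⟨k, hk⟩ := exists_nat_gt ((a N).toReal / η)
  have h1 := hdec k
  have h2 : 0 ≤ (a (N + k)).toReal := ENNReal.toReal_nonneg
  rw [div_lt_iff₀ hη0] at hk
  linarith

end Chain

/-! ### The urn function. -/

/-- A smooth nondecreasing urn function, equal to `1 / 2` on `[0, 19 / 20]` and to `9 / 10` on
`[39 / 40, 1]`. -/
noncomputable def plateau (x : ℝ) : ℝ := 1 / 2 + 2 / 5 * Real.smoothTransition (40 * (x - 19 / 20))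

theorem half_le_plateau (x : ℝ) : 1 / 2 ≤ plateau x := by
  have := Real.smoothTransition.nonneg (40 * (x - 19 / 20))
  unfold plateau
  linarith

theorem plateau_le (x : ℝ) : plateau x ≤ 9 / 10 := by
  have := Real.smoothTransition.le_one (40 * (x - 19 / 20))
  unfold plateau
  linarith

theorem plateau_of_le {x : ℝ} (hx : x ≤ 19 / 20) : plateau x = 1 / 2 := by
  rw [plateau, Real.smoothTransition.zero_of_nonpos (by linarith)]
  norm_num

theorem plateau_of_ge {x : ℝ} (hx : 39 / 40 ≤ x) : plateau x = 9 / 10 := by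
  rw [plateau, Real.smoothTransition.one_of_one_le (by linarith)]
  norm_num

theorem half_lt_plateau {x : ℝ} (hx : 19 / 20 < x) : 1 / 2 < plateau x := by
  have := Real.smoothTransition.pos_of_pos (x := 40 * (x - 19 / 20)) (by linarith)
  unfold plateau
  linarith

theorem plateau_monotone : Monotone plateau := by
  intro x y h
  have := Real.smoothTransition.monotone (a := 40 * (x - 19 / 20)) (b := 40 * (y - 19 / 20))
    (by linarith)
  unfold plateau
  linarith

theorem plateau_continuous : Continuous plateau := by
  have := Real.smoothTransition.continuous
  unfold plateau
  fun_prop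

theorem plateau_mem_Icc (x : ℝ) : plateau x ∈ Icc (0 : ℝ) 1 :=
  ⟨by linarith [half_le_plateau x], by linarith [plateau_le x]⟩

/-- Beyond `19 / 20` the graph lies below the diagonal, because the values never exceed `9 / 10`. -/
theorem plateau_eq_self_iff {p : ℝ} : plateau p = p ↔ p = 1 / 2 := by
  constructor
  · intro h
    by_cases hp : p ≤ 19 / 20
    · rw [← h, plateau_of_le hp]
    · have := plateau_le p
      linarith
  · rintro rfl
    exact plateau_of_le (by norm_num)

theorem isUrnFunction_plateau : IsUrnFunction plateau where
  contDiffOn := by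
    have h : ContDiff ℝ 3 Real.smoothTransition := Real.smoothTransition.contDiff (n := 3)
    have h2 : ContDiff ℝ 3 fun x : ℝ => 40 * (x - 19 / 20) := by fun_prop
    exact (contDiff_const.add (contDiff_const.mul (h.comp h2))).contDiffOn
  mapsTo x _ := ⟨by linarith [half_le_plateau x], by linarith [plateau_le x]⟩
  isolated p _ hp := by
    filter_upwards [self_mem_nhdsWithin] with x hx _ hfx
    exact hx ((plateau_eq_self_iff.1 hfx).trans (plateau_eq_self_iff.1 hp).symm)

theorem isStableFixedPoint_plateau_iff (p : ℝ) : IsStableFixedPoint plateau p ↔ p = 1 / 2 := by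
  constructor
  · exact fun h => plateau_eq_self_iff.1 h.2.1
  · rintro rfl
    refine ⟨by constructor <;> norm_num, plateau_eq_self_iff.2 rfl, ?_⟩
    have h : plateau =ᶠ[𝓝[Icc 0 1] (1 / 2)] fun _ => 1 / 2 := by
      refine Filter.Eventually.filter_mono nhdsWithin_le_nhds ?_
      filter_upwards [Iic_mem_nhds (show (1 / 2 : ℝ) < 19 / 20 by norm_num)] with x hx
      exact plateau_of_le hx
    rw [h.derivWithin_eq (plateau_eq_self_iff.2 rfl)]
    simp

/-! ### The total drift as a function of the initial urn size. -/

theorem lintegral_heads_urnLaw (p : ℕ → ℕ → ℝ) (g : ℕ → ENNReal) (j : ℕ) :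
    ∫⁻ a, g (heads a j) ∂urnLaw p = ∫⁻ u, g (urnHeads p u j)
      ∂(Measure.infinitePi fun _ : ℕ => (volume : Measure unitInterval)) := by
  rw [urnLaw, lintegral_map (measurable_heads_comp g j) (measurable_urnDraws p)]
  simp_rw [heads_urnDraws]

/-- Couplings of urns with ordered probabilities. -/
theorem urnHeads_le_urnHeads {p q : ℕ → ℕ → ℝ} (h : ∀ c c' i, c ≤ c' → p c i ≤ q c' i)
    (u : ℕ → unitInterval) (i : ℕ) : urnHeads p u i ≤ urnHeads q u i := by
  induction i with
  | zero => exact le_rfl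
  | succ i ih =>
    rw [urnHeads, urnHeads]
    have := h _ _ i ih
    by_cases h1 : (u i : ℝ) ≤ p (urnHeads p u i) i
    · rw [if_pos h1, if_pos (h1.trans this)]
      omega
    · rw [if_neg h1]
      omega

theorem totalDrift_mono {p q : ℕ → ℕ → ℝ} (h : ∀ c c' i, c ≤ c' → p c i ≤ q c' i) :
    totalDrift p (urnLaw p) ≤ totalDrift q (urnLaw q) := by
  refine ENNReal.tsum_le_tsum fun j => ?_
  rw [lintegral_heads_urnLaw p (fun c => ENNReal.ofReal (2 * p c j - 1)),
    lintegral_heads_urnLaw q (fun c => ENNReal.ofReal (2 * q c j - 1))]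
  refine lintegral_mono fun u => ENNReal.ofReal_le_ofReal ?_
  have := h _ _ j (urnHeads_le_urnHeads h u j)
  linarith

/-- The expected drift of a site with initial urn `(1 / 2, l)`. -/
noncomputable def plateauDrift (l : ℝ) : ENNReal :=
  totalDrift (urnProb plateau (1 / 2) l) (urnLaw (urnProb plateau (1 / 2) l))

theorem urnProb_plateau_mem (l : ℝ) (c i : ℕ) : urnProb plateau (1 / 2) l c i ∈ Icc (0 : ℝ) 1 :=
  plateau_mem_Icc _

theorem plateauDrift_antitone {l l' : ℝ} (hl : 0 < l) (h : l ≤ l') :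
    plateauDrift l' ≤ plateauDrift l := by
  refine totalDrift_mono fun c c' i hc => ?_
  unfold urnProb
  have hi : (0 : ℝ) ≤ i := Nat.cast_nonneg i
  have hcr : (c : ℝ) ≤ c' := Nat.cast_le.2 hc
  -- Up to half of `true`s, the proportion stays at most `1 / 2`, where the function is flat; above
  -- half, enlarging the urn pulls the proportion down towards `1 / 2`.
  by_cases hs : (c : ℝ) ≤ i / 2
  · rw [plateau_of_le]
    · exact half_le_plateau _
    · rw [div_le_iff₀ (by linarith)]
      linarith
  · refine plateau_monotone ?_
    rw [div_le_div_iff₀ (by linarith) (by linarith)]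
    push Not at hs
    nlinarith [mul_nonneg (sub_nonneg.2 h) (sub_nonneg.2 hs.le),
      mul_nonneg (sub_nonneg.2 hcr) (show 0 ≤ l' + i by linarith)]

/-- A Chernoff bound: positive drift requires very few `false`s, an event whose probability decays
geometrically in the number of draws, with a prefactor that is small for large urns. -/
theorem exists_plateauDrift_le_one : ∃ l : ℝ, 0 < l ∧ plateauDrift l ≤ 1 := by
  -- Drift at draw `j` needs `20 * (number of falses) + 9 * n < j`; weighting each `false` by `s = t
  -- ^ 20` turns this into a power of `t`. Since `p ≤ 9 / 10`, each draw multiplies the mean weight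
  -- by at most `r`, and `r < t`.
  set t : ℝ := 19 / 20 with ht
  set s : ℝ := t ^ 20 with hs
  set r : ℝ := 9 / 10 + 1 / 10 * s with hr
  set ρ : ℝ := r / t with hρ
  have hs0 : 0 ≤ s := by positivity
  have hs1 : s ≤ 1 := by rw [hs, ht]; norm_num
  have hr0 : 0 ≤ r := by positivity
  have hρ0 : 0 ≤ ρ := by positivity
  have hρ1 : ρ < 1 := by rw [hρ, hr, hs, ht]; norm_num
  obtain ⟨m, hm⟩ := exists_pow_lt_of_lt_one (show 0 < 1 - ρ by linarith)
    (show t < 1 by rw [ht]; norm_num)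
  set n : ℕ := m + 1 with hn
  have htn : t ^ (9 * n) ≤ 1 - ρ :=
    (pow_le_pow_of_le_one (by positivity) (by rw [ht]; norm_num) (by omega)).trans hm.le
  refine ⟨n, by positivity, ?_⟩
  set p := urnProb plateau (1 / 2) n with hp
  have hlaw : IsUrnLaw p (urnLaw p) := isUrnLaw_urnLaw (urnProb_plateau_mem _)
  have hw : ∀ j, ∫⁻ a, ENNReal.ofReal (s ^ (j - heads a j)) ∂urnLaw p ≤ ENNReal.ofReal (r ^ j) := by
    intro j
    induction j with
    | zero => simp
    | succ j ih =>
      have h1 : ∀ a : ℕ → Bool, ENNReal.ofReal (s ^ (j + 1 - heads a (j + 1))) =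
          (fun (c : ℕ) (x : Bool) => if c ≤ j then
            ENNReal.ofReal (s ^ (j - c) * (if x = true then 1 else s)) else 0)
              (heads a j) (a j) := by
        intro a
        have hle := heads_le a j
        simp only [if_pos hle]
        rw [heads_succ]
        cases a j
        · have : j + 1 - heads a j = (j - heads a j) + 1 := by omega
          simp [this, pow_succ]
        · simp
      rw [lintegral_congr h1, hlaw.lintegral j (fun (c : ℕ) (x : Bool) => if c ≤ j then
            ENNReal.ofReal (s ^ (j - c) * (if x = true then 1 else s)) else 0)]
      have h2 : ∀ a : ℕ → Bool, ENNReal.ofReal (p (heads a j) j) * (if heads a j ≤ j then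
            ENNReal.ofReal (s ^ (j - heads a j) * (if true = true then 1 else s)) else 0) +
          ENNReal.ofReal (1 - p (heads a j) j) * (if heads a j ≤ j then
            ENNReal.ofReal (s ^ (j - heads a j) * (if false = true then 1 else s)) else 0) ≤
          ENNReal.ofReal r * ENNReal.ofReal (s ^ (j - heads a j)) := by
        intro a
        have hle := heads_le a j
        have hp0 : 1 / 2 ≤ p (heads a j) j := half_le_plateau _
        have hp1 : p (heads a j) j ≤ 9 / 10 := plateau_le _
        have hsp : 0 ≤ s ^ (j - heads a j) := by positivity
        simp only [if_pos hle, if_true, Bool.false_eq_true, if_false]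
        rw [← ENNReal.ofReal_mul (by linarith), ← ENNReal.ofReal_mul (by linarith),
          ← ENNReal.ofReal_mul hr0, ← ENNReal.ofReal_add
            (mul_nonneg (by linarith) (by linarith))
            (mul_nonneg (by linarith) (mul_nonneg hsp hs0))]
        refine ENNReal.ofReal_le_ofReal ?_
        have h3 : 0 ≤ (9 / 10 - p (heads a j) j) * (1 - s) :=
          mul_nonneg (by linarith) (by linarith)
        have h4 := mul_nonneg h3 hsp
        rw [hr]
        nlinarith
      refine (lintegral_mono h2).trans ?_
      rw [lintegral_const_mul' _ _ ENNReal.ofReal_ne_top, pow_succ, mul_comm (r ^ j),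
        ENNReal.ofReal_mul hr0]
      gcongr
  have hterm : ∀ j, ∫⁻ a, ENNReal.ofReal (2 * p (heads a j) j - 1) ∂urnLaw p ≤
      ENNReal.ofReal (t ^ (9 * n) * ρ ^ j) := by
    intro j
    have h1 : ∀ a : ℕ → Bool, ENNReal.ofReal (2 * p (heads a j) j - 1) ≤
        ENNReal.ofReal (t ^ (9 * n) / t ^ j) * ENNReal.ofReal (s ^ (j - heads a j)) := by
      intro a
      have hle := heads_le a j
      have hn0 : (0 : ℝ) < n := by positivity
      have hj0 : (0 : ℝ) ≤ j := Nat.cast_nonneg j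
      by_cases hx : (1 / 2 * (n : ℝ) + heads a j) / (n + j) ≤ 19 / 20
      · rw [hp, urnProb, plateau_of_le hx]
        norm_num
      · push Not at hx
        rw [lt_div_iff₀ (by linarith)] at hx
        have h2 : 20 * (j - heads a j) + 9 * n ≤ j := by
          have h3 : (19 * j + 9 * n : ℝ) < 20 * heads a j := by linarith
          have h4 : 19 * j + 9 * n < 20 * heads a j := by exact_mod_cast h3
          omega
        have hp1 : p (heads a j) j ≤ 9 / 10 := plateau_le _
        rw [← ENNReal.ofReal_mul (by positivity)]
        refine ENNReal.ofReal_le_ofReal (le_trans (b := 1) (by linarith) ?_)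
        rw [div_mul_eq_mul_div, le_div_iff₀ (by positivity), one_mul, hs, ← pow_mul, ← pow_add]
        -- On the drift event `t ^ (9 * n) * s ^ (j - heads a j)` is at least `t ^ j`, so the weight
        -- dominates the indicator.
        exact pow_le_pow_of_le_one (by positivity) (by rw [ht]; norm_num) (by omega)
    refine (lintegral_mono h1).trans ?_
    rw [lintegral_const_mul' _ _ ENNReal.ofReal_ne_top]
    calc ENNReal.ofReal (t ^ (9 * n) / t ^ j) *
          ∫⁻ a, ENNReal.ofReal (s ^ (j - heads a j)) ∂urnLaw p
        ≤ ENNReal.ofReal (t ^ (9 * n) / t ^ j) * ENNReal.ofReal (r ^ j) := by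
          gcongr
          exact hw j
      _ = _ := by
          have hpow : ρ ^ j = r ^ j / t ^ j := div_pow r t j
          rw [← ENNReal.ofReal_mul (by positivity), hpow, div_mul_eq_mul_div, mul_div_assoc]
  calc plateauDrift n ≤ ∑' j, ENNReal.ofReal (t ^ (9 * n) * ρ ^ j) := ENNReal.tsum_le_tsum hterm
    _ = ENNReal.ofReal (t ^ (9 * n) * (1 - ρ)⁻¹) := by
        rw [← ENNReal.ofReal_tsum_of_nonneg (fun j => by positivity)
          ((summable_geometric_of_lt_one hρ0 hρ1).mul_left _), tsum_mul_left,
          tsum_geometric_of_lt_one hρ0 hρ1]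
    _ ≤ 1 := by
        rw [ENNReal.ofReal_le_one, ← div_eq_mul_inv, div_le_one (by linarith)]
        exact htn

theorem prefix_true_le_lintegral (ν : Measure (ℕ → Bool)) (g : ℕ → ENNReal) (j : ℕ) :
    g j * ν {a | ∀ i < j, a i = true} ≤ ∫⁻ a, g (heads a j) ∂ν := by
  have hm : MeasurableSet {a : ℕ → Bool | ∀ i < j, a i = true} :=
    measurableSet_prefix (fun _ => true) j
  rw [← lintegral_indicator_const hm]
  refine lintegral_mono fun a => ?_
  by_cases h : a ∈ {a : ℕ → Bool | ∀ i < j, a i = true}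
  · rw [indicator_of_mem h]
    have : heads a j = j := Nat.count_iff_forall.2 h
    rw [this]
  · rw [indicator_of_notMem h]
    exact zero_le

theorem heads_const_true (j : ℕ) : heads (fun _ => true) j = j := by
  simp [heads]

theorem urnLaw_prefix_true {p : ℕ → ℕ → ℝ} (hp : ∀ c i, p c i ∈ Icc (0 : ℝ) 1) (j : ℕ) :
    urnLaw p {a | ∀ i < j, a i = true} = ∏ i ∈ Finset.range j, ENNReal.ofReal (p i i) := by
  rw [urnLaw_prefix hp fun _ => true]
  simp [heads_const_true]

/-- Consider only runs of `true`s. The first has probability `1 / 2`; as `19 * l ≤ 1`, it already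
pushes the proportion past `39 / 40`, giving drift `4 / 5` and probability `9 / 10` to each later
one. Three terms sum to `1.084`. -/
theorem one_lt_plateauDrift {l : ℝ} (hl : 0 < l) (hl' : l ≤ 1 / 20) : 1 < plateauDrift l := by
  set p := urnProb plateau (1 / 2) l with hp
  have hp0 : p 0 0 = 1 / 2 := by
    rw [hp, urnProb]
    simp only [Nat.cast_zero, add_zero]
    rw [mul_div_assoc, div_self hl.ne']
    exact plateau_of_le (by norm_num)
  have hpi : ∀ i, p (i + 1) (i + 1) = 9 / 10 := by
    intro i
    rw [hp, urnProb]
    refine plateau_of_ge ?_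
    have hi : (0 : ℝ) ≤ i := Nat.cast_nonneg i
    push_cast
    rw [le_div_iff₀ (by linarith)]
    linarith
  have hterm : ∀ j, ENNReal.ofReal (2 / 5 * (9 / 10) ^ j) ≤
      ∫⁻ a, ENNReal.ofReal (2 * p (heads a (j + 1)) (j + 1) - 1) ∂urnLaw p := by
    intro j
    refine le_trans (le_of_eq ?_)
      (prefix_true_le_lintegral _ (fun c => ENNReal.ofReal (2 * p c (j + 1) - 1)) (j + 1))
    rw [urnLaw_prefix_true (urnProb_plateau_mem l), Finset.prod_range_succ', ← hp, hp0]
    simp_rw [hpi]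
    rw [Finset.prod_const, Finset.card_range, ← ENNReal.ofReal_pow (by norm_num),
      ← ENNReal.ofReal_mul (by positivity), ← ENNReal.ofReal_mul (by norm_num)]
    congr 1
    ring
  calc (1 : ENNReal) < ENNReal.ofReal (2 / 5 * (9 / 10) ^ 0 + 2 / 5 * (9 / 10) ^ 1 +
          2 / 5 * (9 / 10) ^ 2) := by
        rw [ENNReal.one_lt_ofReal]
        norm_num
    _ = ENNReal.ofReal (2 / 5 * (9 / 10) ^ 0) + ENNReal.ofReal (2 / 5 * (9 / 10) ^ 1) +
          ENNReal.ofReal (2 / 5 * (9 / 10) ^ 2) := by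
        rw [ENNReal.ofReal_add (by positivity) (by positivity),
          ENNReal.ofReal_add (by positivity) (by positivity)]
    _ ≤ 0 + ∫⁻ a, ENNReal.ofReal (2 * p (heads a 1) 1 - 1) ∂urnLaw p +
          ∫⁻ a, ENNReal.ofReal (2 * p (heads a 2) 2 - 1) ∂urnLaw p +
          ∫⁻ a, ENNReal.ofReal (2 * p (heads a 3) 3 - 1) ∂urnLaw p := by
        rw [zero_add]
        exact add_le_add (add_le_add (hterm 0) (hterm 1)) (hterm 2)
    _ ≤ ∑ j ∈ Finset.range 4, ∫⁻ a, ENNReal.ofReal (2 * p (heads a j) j - 1) ∂urnLaw p := by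
        simp only [Finset.sum_range_succ, Finset.sum_range_zero, zero_add]
        gcongr
        exact le_add_self
    _ ≤ plateauDrift l := ENNReal.sum_le_tsum _

theorem siteDrift_lt_one {l : ℝ} (hl : 0 < l) (h : plateauDrift l ≤ 1) (v : ℕ) :
    siteDrift (urnProb plateau (1 / 2) l) (urnLaw (urnProb plateau (1 / 2) l)) v < 1 := by
  set p := urnProb plateau (1 / 2) l with hp
  -- After `j > 9 * l` draws, all `true`, the proportion exceeds `19 / 20`; taking also `j > v`
  -- leaves positive drift uncounted by `siteDrift`.
  obtain ⟨k, hk⟩ := exists_nat_gt (9 * l)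
  set j := v + 1 + k with hj
  have hle := (siteDrift_add_le p (urnLaw p) v j).trans h
  have hpos : 0 < ∫⁻ a, (if v < heads a j then ENNReal.ofReal (2 * p (heads a j) j - 1) else 0)
      ∂urnLaw p := by
    refine lt_of_lt_of_le ?_ (prefix_true_le_lintegral _
      (fun c => if v < c then ENNReal.ofReal (2 * p c j - 1) else 0) j)
    rw [urnLaw_prefix_true (urnProb_plateau_mem l), if_pos (by omega)]
    refine ENNReal.mul_pos ?_ ?_
    · rw [Ne, ENNReal.ofReal_eq_zero, not_le, sub_pos]
      have : 1 / 2 < p j j := by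
        refine half_lt_plateau ?_
        have hv : (0 : ℝ) ≤ v := Nat.cast_nonneg v
        have hk0 : (0 : ℝ) ≤ k := Nat.cast_nonneg k
        rw [hj]
        push_cast
        rw [lt_div_iff₀ (by linarith)]
        linarith
      linarith
    · rw [Finset.prod_ne_zero_iff]
      intro i _
      rw [Ne, ENNReal.ofReal_eq_zero, not_le]
      have := half_le_plateau ((1 / 2 * l + i) / (l + i))
      change 0 < plateau ((1 / 2 * l + i) / (l + i))
      linarith
  have hfin : siteDrift p (urnLaw p) v ≠ ⊤ :=
    ne_top_of_le_ne_top ENNReal.one_ne_top (le_self_add.trans hle)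
  exact (ENNReal.lt_add_right hfin hpos.ne').trans_le hle

/-- The first `j` draws take finitely many values, so the integral is a finite sum of products of
continuous functions of `l`. -/
theorem continuousAt_lintegral_urnProb (j : ℕ) {l : ℝ} (hl : 0 < l) :
    ContinuousAt (fun l => ∫⁻ a, ENNReal.ofReal (2 * urnProb plateau (1 / 2) l (heads a j) j - 1)
      ∂urnLaw (urnProb plateau (1 / 2) l)) l := by
  have hp : ∀ c i : ℕ, ContinuousAt (fun l => urnProb plateau (1 / 2) l c i) l := by
    intro c i
    unfold urnProb
    have hi : (0 : ℝ) ≤ i := Nat.cast_nonneg i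
    refine plateau_continuous.continuousAt.comp (f := fun l : ℝ => (1 / 2 * l + c) / (l + i)) ?_
    exact ContinuousAt.div (by fun_prop) (by fun_prop) (by linarith)
  have heq : (fun l => ∫⁻ a, ENNReal.ofReal (2 * urnProb plateau (1 / 2) l (heads a j) j - 1)
      ∂urnLaw (urnProb plateau (1 / 2) l)) = fun l => ENNReal.ofReal (∑ b : Fin j → Bool,
        (2 * urnProb plateau (1 / 2) l (heads (extendBool b) j) j - 1) *
          ∏ i ∈ Finset.range j, (if extendBool b i then
            urnProb plateau (1 / 2) l (heads (extendBool b) i) i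
              else 1 - urnProb plateau (1 / 2) l (heads (extendBool b) i) i)) := by
    funext l
    have hnn : ∀ (b : ℕ → Bool) (i : ℕ), 0 ≤ if b i then
        urnProb plateau (1 / 2) l (heads b i) i
          else 1 - urnProb plateau (1 / 2) l (heads b i) i := by
      intro b i
      have := urnProb_plateau_mem l (heads b i) i
      split_ifs
      · exact this.1
      · linarith [this.2]
    have hd : ∀ c i, 0 ≤ 2 * urnProb plateau (1 / 2) l c i - 1 := fun c i => by
      have := half_le_plateau ((1 / 2 * l + c) / (l + i))
      unfold urnProb
      linarith
    rw [lintegral_prefix _ (m := j) fun a b h => by rw [heads_congr h],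
      ENNReal.ofReal_sum_of_nonneg fun b _ =>
        mul_nonneg (hd _ _) (Finset.prod_nonneg fun i _ => hnn _ i)]
    refine Finset.sum_congr rfl fun b _ => ?_
    rw [urnLaw_prefix (urnProb_plateau_mem l), ENNReal.ofReal_mul (hd _ _),
      ENNReal.ofReal_prod_of_nonneg fun i _ => hnn _ i]
  rw [heq]
  refine ENNReal.continuous_ofReal.continuousAt.comp ?_
  refine tendsto_finsetSum _ fun b _ => ?_
  refine Tendsto.mul ((((hp _ _).const_mul 2)).sub tendsto_const_nhds) ?_
  refine tendsto_finsetProd _ fun i _ => ?_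
  split_ifs
  · exact hp _ _
  · exact tendsto_const_nhds.sub (hp _ _)

/-- The total drift is a supremum of continuous partial sums, hence lower semicontinuous. -/
theorem eventually_one_lt_plateauDrift {l : ℝ} (hl : 0 < l) (h : 1 < plateauDrift l) :
    ∀ᶠ l' in 𝓝 l, 1 < plateauDrift l' := by
  rw [plateauDrift, totalDrift, ENNReal.tsum_eq_iSup_nat, lt_iSup_iff] at h
  obtain ⟨m, hm⟩ := h
  have hc : ContinuousAt (fun l => ∑ j ∈ Finset.range m,
      ∫⁻ a, ENNReal.ofReal (2 * urnProb plateau (1 / 2) l (heads a j) j - 1)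
        ∂urnLaw (urnProb plateau (1 / 2) l)) l :=
    tendsto_finsetSum _ fun j _ => continuousAt_lintegral_urnProb j hl
  filter_upwards [hc.eventually_const_lt hm] with l' hl'
  exact hl'.trans_le (ENNReal.sum_le_tsum _)

/-- The drift of a site is at most one exactly from some positive initial urn size on. -/
theorem exists_threshold : ∃ l₁ : ℝ, 0 < l₁ ∧ ∀ l : ℝ, 0 < l →
    (plateauDrift l ≤ 1 ↔ l₁ ≤ l) := by
  set S : Set ℝ := {l | 0 < l ∧ plateauDrift l ≤ 1} with hS
  have hne : S.Nonempty := exists_plateauDrift_le_one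
  have hlow : ∀ l ∈ S, (1 / 20 : ℝ) ≤ l := by
    rintro l ⟨h0, h1⟩
    by_contra hc
    exact (one_lt_plateauDrift h0 (not_le.1 hc).le).not_ge h1
  have hbdd : BddBelow S := ⟨1 / 20, hlow⟩
  have hpos : 0 < sInf S := lt_of_lt_of_le (by norm_num) (le_csInf hne hlow)
  -- Openness of `{D > 1}` puts the infimum itself in `S`, so the recurrent range includes its
  -- endpoint.
  have hmem : plateauDrift (sInf S) ≤ 1 := by
    by_contra hc
    obtain ⟨δ, hδ, hball⟩ :=
      Metric.eventually_nhds_iff.1 (eventually_one_lt_plateauDrift hpos (not_le.1 hc))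
    obtain ⟨l, hlS, hl⟩ := exists_lt_of_csInf_lt hne (show sInf S < sInf S + δ by linarith)
    have h1 := csInf_le hbdd hlS
    have h2 := hball (y := l) (by rw [Real.dist_eq, abs_lt]; constructor <;> linarith)
    exact h2.not_ge hlS.2
  refine ⟨sInf S, hpos, fun l hl => ⟨fun h => csInf_le hbdd ⟨hl, h⟩, fun h => ?_⟩⟩
  exact (plateauDrift_antitone hpos h).trans hmem

/-! ### From the branching process to almost sure behaviour of the walk. -/

theorem measurableSet_isRecurrentPath : MeasurableSet {X : ℕ → ℤ | IsRecurrentPath X} := by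
  have : {X : ℕ → ℤ | IsRecurrentPath X} =
      ⋂ x : ℤ, limsup (fun n : ℕ => {X : ℕ → ℤ | X n = x}) atTop := by
    ext X
    simp only [mem_iInter, mem_limsup_iff_frequently_mem]
    rfl
  rw [this]
  exact MeasurableSet.iInter fun x => MeasurableSet.measurableSet_limsup fun n =>
    measurableSet_eq_fun (measurable_pi_apply n) measurable_const

theorem measurableSet_isTransientPath : MeasurableSet {X : ℕ → ℤ | IsTransientPath X} :=
  (measurableSet_tendsto atTop fun n => measurable_pi_apply n).union
    (measurableSet_tendsto atBot fun n => measurable_pi_apply n)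

section Stacks

variable {ν : Measure (ℕ → Bool)} [IsProbabilityMeasure ν]

theorem map_stacks_right : (Measure.infinitePi fun _ : ℤ => ν).map
    (fun (ω : ℤ → ℕ → Bool) (x : ℕ) => ω x) = Measure.infinitePi fun _ : ℕ => ν :=
  Measure.map_infinitePi_infinitePi_of_inj (P := fun _ : ℤ => ν) Nat.cast_injective

theorem measurable_stacks_right :
    Measurable fun (ω : ℤ → ℕ → Bool) (x : ℕ) => ω (x : ℤ) :=
  measurable_pi_lambda _ fun x => measurable_pi_apply (x : ℤ)

theorem measurable_not : Measurable fun (a : ℕ → Bool) (i : ℕ) => !a i :=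
  measurable_pi_lambda _ fun i => (measurable_of_finite not).comp (measurable_pi_apply i)

theorem map_stacks_left : (Measure.infinitePi fun _ : ℤ => ν).map
    (fun (ω : ℤ → ℕ → Bool) (x : ℕ) (i : ℕ) => !ω (-x) i) =
      Measure.infinitePi fun _ : ℕ => ν.map fun a i => !a i := by
  rw [← Measure.infinitePi_map_pi (μ := fun _ : ℕ => ν) fun _ => measurable_not,
    ← Measure.map_infinitePi_infinitePi_of_inj (P := fun _ : ℤ => ν) (f := fun x : ℕ => -(x : ℤ))
      (neg_injective.comp Nat.cast_injective), Measure.map_map]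
  · rfl
  · exact measurable_pi_lambda _ fun x => measurable_not.comp (measurable_pi_apply x)
  · fun_prop

theorem measurable_stacks_left :
    Measurable fun (ω : ℤ → ℕ → Bool) (x : ℕ) (i : ℕ) => !ω (-(x : ℤ)) i :=
  measurable_pi_lambda _ fun x => measurable_not.comp
    (measurable_pi_apply (X := fun _ : ℤ => ℕ → Bool) (-(x : ℤ)))

theorem lt_of_notMem_boundedStacks {ω : ℕ → ℕ → Bool} (h : ω ∉ boundedStacks) (M : ℕ) :
    ∃ n, M < chain ω n := by
  by_contra hc
  push Not at hc
  exact h ⟨M, hc⟩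

variable {p : ℕ → ℕ → ℝ}

/-- The walk following independent stacks of urn draws is recurrent if the drift at a site is
nonnegative and its expectation, up to any number of draws, is below one. -/
theorem ae_isRecurrentPath_walk (hν : IsUrnLaw p ν) (hmix : ∀ᵐ a ∂ν, IsMixed a)
    (hp : ∀ c i, 1 / 2 ≤ p c i) (hp1 : ∀ c i, p c i ≤ 1) (hd : ∀ v, siteDrift p ν v < 1) :
    ∀ᵐ ω ∂(Measure.infinitePi fun _ : ℤ => ν), IsRecurrentPath (walk ω) := by
  have : IsProbabilityMeasure (ν.map fun (a : ℕ → Bool) (i : ℕ) => !a i) :=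
    Measure.isProbabilityMeasure_map measurable_not.aemeasurable
  have hp0 : ∀ c i, p c i ∈ Icc (0 : ℝ) 1 := fun c i => ⟨by linarith [hp c i], hp1 c i⟩
  have hr : ∀ᵐ ω ∂(Measure.infinitePi fun _ : ℤ => ν),
      (fun x : ℕ => ω (x : ℤ)) ∉ boundedStacks := by
    have h1 := ae_notMem_boundedStacks hν hmix hp0 hd
    rw [← map_stacks_right] at h1
    exact ae_of_ae_map (f := fun (ω : ℤ → ℕ → Bool) (x : ℕ) => ω x)
      measurable_stacks_right.aemeasurable h1
  have hl : ∀ᵐ ω ∂(Measure.infinitePi fun _ : ℤ => ν),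
      (fun (x : ℕ) (i : ℕ) => !ω (-(x : ℤ)) i) ∉ boundedStacks := by
    have hmix' : ∀ᵐ a ∂(ν.map fun (a : ℕ → Bool) (i : ℕ) => !a i), IsMixed a := by
      rw [ae_map_iff measurable_not.aemeasurable measurableSet_isMixed]
      exact hmix.mono fun a ha => ha.not
    -- The mirrored probabilities are at most `1 / 2`, so their drift is nonpositive and its
    -- positive part vanishes.
    have hd' : ∀ v, siteDrift (fun c i => 1 - p (i - c) i)
        (ν.map fun (a : ℕ → Bool) (i : ℕ) => !a i) v < 1 := by
      intro v
      have : siteDrift (fun c i => 1 - p (i - c) i)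
          (ν.map fun (a : ℕ → Bool) (i : ℕ) => !a i) v = 0 := by
        refine ENNReal.tsum_eq_zero.2 fun j => ?_
        refine (lintegral_congr fun a => ?_).trans lintegral_zero
        have h2 := hp (j - heads a j) j
        rw [ENNReal.ofReal_of_nonpos (by linarith), ite_self]
      rw [this]
      exact one_pos
    have h1 := ae_notMem_boundedStacks hν.map_not hmix'
      (fun c i => ⟨by linarith [hp1 (i - c) i], by linarith [hp (i - c) i]⟩) hd'
    rw [← map_stacks_left] at h1
    exact ae_of_ae_map (f := fun (ω : ℤ → ℕ → Bool) (x : ℕ) (i : ℕ) => !ω (-(x : ℤ)) i)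
      measurable_stacks_left.aemeasurable h1
  filter_upwards [hr, hl, ae_forall_isMixed (ι := ℤ) hmix] with ω h1 h2 h3
  exact (follows_walk ω).isRecurrentPath_of_chain h3 (lt_of_notMem_boundedStacks h1)
    (lt_of_notMem_boundedStacks h2)

/-- The walk following independent stacks of urn draws is transient if the drift at a site is
nonnegative and its expectation exceeds one. -/
theorem ae_isTransientPath_walk (hν : IsUrnLaw p ν) (hmix : ∀ᵐ a ∂ν, IsMixed a)
    (hp : ∀ c i, 1 / 2 ≤ p c i) (hp1 : ∀ c i, p c i ≤ 1) (hd : 1 < totalDrift p ν) :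
    ∀ᵐ ω ∂(Measure.infinitePi fun _ : ℤ => ν), IsTransientPath (walk ω) := by
  have hr : ∀ᵐ ω ∂(Measure.infinitePi fun _ : ℤ => ν),
      (fun x : ℕ => ω (x : ℤ)) ∈ boundedStacks := by
    have h1 := ae_mem_boundedStacks hν hmix hp hp1 hd
    rw [← map_stacks_right] at h1
    exact ae_of_ae_map (f := fun (ω : ℤ → ℕ → Bool) (x : ℕ) => ω x)
      measurable_stacks_right.aemeasurable h1
  filter_upwards [hr, ae_forall_isMixed (ι := ℤ) hmix] with ω h1 h2
  obtain ⟨M, hM⟩ := h1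
  exact (follows_walk ω).isTransientPath_of_chain h2 hM

end Stacks

theorem theorem3 :
    ∃ f : ℝ → ℝ, IsUrnFunction f ∧ (∀ a ∈ Icc (0 : ℝ) 1, 1 / 2 ≤ f a) ∧
      (∀ p : ℝ, IsStableFixedPoint f p ↔ p = 1 / 2) ∧
      ∃ l₁ : ℝ, 0 < l₁ ∧ ∀ l : ℝ, 0 < l →
        (l₁ ≤ l → ∀ᵐ X ∂(reinforcedWalkLaw f 0 fun _ => (1 / 2, l)), IsRecurrentPath X) ∧
        (l < l₁ → ∀ᵐ X ∂(reinforcedWalkLaw f 0 fun _ => (1 / 2, l)), IsTransientPath X) := by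
  obtain ⟨l₁, hl₁, hthr⟩ := exists_threshold
  refine ⟨plateau, isUrnFunction_plateau, fun a _ => half_le_plateau a,
    isStableFixedPoint_plateau_iff, l₁, hl₁, fun l hl => ?_⟩
  set p := urnProb plateau (1 / 2) l
  have hlaw : IsUrnLaw p (urnLaw p) := isUrnLaw_urnLaw (urnProb_plateau_mem l)
  have hp : ∀ c i, 1 / 2 ≤ p c i := fun c i => half_le_plateau _
  have hp' : ∀ c i, p c i ≤ 9 / 10 := fun c i => plateau_le _
  have hmix : ∀ᵐ a ∂urnLaw p, IsMixed a :=
    ae_isMixed_urnLaw (q := 1 / 10) (by norm_num) (fun c i => by linarith [hp c i])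
      fun c i => by linarith [hp' c i]
  have hp1 : ∀ c i, p c i ≤ 1 := fun c i => by linarith [hp' c i]
  rw [← map_walk_eq_reinforcedWalkLaw plateau_mem_Icc]
  constructor
  · intro h
    rw [ae_map_iff measurable_walk.aemeasurable measurableSet_isRecurrentPath]
    exact ae_isRecurrentPath_walk hlaw hmix hp hp1 (siteDrift_lt_one hl ((hthr l hl).2 h))
  · intro h
    rw [ae_map_iff measurable_walk.aemeasurable measurableSet_isTransientPath]
    refine ae_isTransientPath_walk hlaw hmix hp hp1 ?_
    by_contra hc
    exact h.not_ge ((hthr l hl).1 (not_lt.1 hc))
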